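/- \textbf{Definitions.} An operation $\mathsf{read}_i(x,v)$ or $\mathsf{write}_i(x,v)$ has an identifier $i$, a variable $x$ and a value $v$; a transaction is a finite set of operations with a strict total order on it (program order). A (finite) history $h=\langle T,\mathsf{so},\mathsf{wr}\rangle$ consists of a finite set $T$ of transactions, a strict partial order $\mathsf{so}$ on $T$ (session order), and a relation $\mathsf{wr}$ between transactions in $T$ and read operations of transactions in $T$, such that every read operation $r$ occurring in $T$ has exactly one $t$ with $(t,r)\in\mathsf{wr}$; if $(t,\mathsf{read}_i(x,v))\in\mathsf{wr}$ then $t$ contains a write of $v$ to $x$; and $\mathsf{so}\cup\mathsf{wr}$ is acyclic. Here and below $\mathsf{wr}$ is extended to transactions: $(t_1,t_2)\in\mathsf{wr}_x$ iff $(t_1,r)\in\mathsf{wr}$ for some read operation $r$ of the variable $x$ in $t_2$, and $\mathsf{wr}=\bigcup_x\mathsf{wr}_x$. The history is \emph{prefix consistent} if there is a strict total order $\mathsf{co}\supseteq\mathsf{wr}\cup\mathsf{so}$ on $T$ such that for every variable $x$ and all $t_1\neq t_2$ and $t_3$ in $T$: if $(t_1,t_3)\in\mathsf{wr}_x$, $t_2$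 writes $x$, and there is $t_4$ with $(t_2,t_4)\in\mathsf{co}^*$ and $(t_4,t_3)\in\mathsf{wr}\cup\mathsf{so}$, then $(t_2,t_1)\in\mathsf{co}$. The \emph{width} of $h$ is the maximum number of transactions that are mutually unordered by $\mathsf{so}$. \textbf{Statement.} For every fixed $k\in\mathbb N$, the problem of checking prefix consistency for histories of width at most $k$ is polynomial time: there are a program of a random access machine (with addition, truncated subtraction and indirect addressing, but no multiplication, at unit cost) and a polynomial $b$ such that, for every history $h$ of width at most $k$, given as a sequence of $\ell$ natural numbers that lists its transactions with their operations, the pairs in $\mathsf{so}$ and the pairs in $\mathsf{wr}$, the program halts within $b(\ell)$ steps and answers correctly whether $h$ is prefix consistent. -/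

import Mathlib

/-! ### Transactions, histories and prefix consistency -/

/-- An operation with an identifier `i`: it reads the value `v` from the variable `x`, or writes
the value `v` to the variable `x`. Identifiers, variables and values are named by numbers. -/
inductive Op where
  | read (i x v : ℕ)
  | write (i x v : ℕ)

/-- A transaction: a finite set of operations with a strict total order on it (the program order),
that is, a list of operations without repetitions. -/
structure Transaction where
  ops : List Op
  nodup : ops.Nodup

/-- The transaction writes the variable `x`. -/
def Transaction.Writes (t : Transaction) (x : ℕ) : Prop :=
  ∃ i v, Op.write i x v ∈ t.ops

/-- A history whose set of transactions is indexed by `T`, with its session order `so` and its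
write-read relation `wr` (between transactions and read operations). -/
structure History (T : Type*) where
  /-- The transactions. -/
  tr : T → Transaction
  /-- The session order, a strict partial order. -/
  so : T → T → Prop
  so_irrefl : ∀ t, ¬ so t t
  so_trans : ∀ t₁ t₂ t₃, so t₁ t₂ → so t₂ t₃ → so t₁ t₃
  /-- The write-read relation. -/
  wr : T → Op → Prop
  /-- It relates transactions to read operations of the history only. -/
  wr_read : ∀ t o, wr t o → ∃ i x v, o = Op.read i x v ∧ ∃ t', o ∈ (tr t').ops
  /-- The inverse of the write-read relation is a total function on the reads of the history. -/
  wr_total : ∀ t' i x v, Op.read i x v ∈ (tr t').ops → ∃! t, wr t (Op.read i x v)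
  /-- A read returns a value written to the same variable by the transaction it reads from. -/
  wr_value : ∀ t i x v, wr t (Op.read i x v) → ∃ j, Op.write j x v ∈ (tr t).ops
  /-- The union of the session order and of the write-read relation (extended to pairs of
  transactions) is acyclic. -/
  acyclic : ∀ t, ¬ Relation.TransGen
    (fun t₁ t₂ => so t₁ t₂ ∨ ∃ i x v, Op.read i x v ∈ (tr t₂).ops ∧ wr t₁ (Op.read i x v)) t t

namespace History

/-- `t₂` reads the variable `x` from `t₁`. -/
def WrVar {T : Type*} (h : History T) (x : ℕ) (t₁ t₂ : T) : Prop :=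
  ∃ i v, Op.read i x v ∈ (h.tr t₂).ops ∧ h.wr t₁ (Op.read i x v)

/-- The write-read relation extended to pairs of transactions. -/
def Wr {T : Type*} (h : History T) (t₁ t₂ : T) : Prop :=
  ∃ x, h.WrVar x t₁ t₂

/-- The axiom `Prefix` for a history and a commit order `co`. -/
def PrefixAxiom {T : Type*} (h : History T) (co : T → T → Prop) : Prop :=
  ∀ (x : ℕ) (t₁ t₂ t₃ : T), t₁ ≠ t₂ → h.WrVar x t₁ t₃ → (h.tr t₂).Writes x →
    Relation.Comp (Relation.ReflTransGen co) (fun t t' => h.Wr t t' ∨ h.so t t') t₂ t₃ →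
    co t₂ t₁

/-- Prefix consistency: some strict total order on the transactions (the commit order) contains
the write-read relation and the session order, and satisfies the axiom `Prefix`. -/
def PrefixConsistent {T : Type*} (h : History T) : Prop :=
  ∃ co : T → T → Prop, IsStrictTotalOrder T co ∧
    (∀ t₁ t₂, h.Wr t₁ t₂ ∨ h.so t₁ t₂ → co t₁ t₂) ∧ h.PrefixAxiom co

open Classical in
/-- The width: the maximum number of transactions mutually unordered by the session order. -/
noncomputable def width {T : Type*} [Fintype T] (h : History T) : ℕ :=
  (Finset.univ.filter (fun A : Finset T => IsAntichain h.so (A : Set T))).sup Finset.card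

end History

/-! ### Presenting a history to a machine, as a finite sequence of numbers -/

/-- Four numbers for an operation: its kind, its identifier, its variable and its value. -/
def Op.code : Op → List ℕ
  | Op.read i x v => [0, i, x, v]
  | Op.write i x v => [1, i, x, v]

/-- The number of operations of a transaction, and its operations in program order. -/
def Transaction.code (t : Transaction) : List ℕ :=
  t.ops.length :: t.ops.flatMap Op.code

/-- The sequence `w` presents the history `h` with transactions `0, …, n - 1`: it consists of the
number of transactions and the transactions, of a list of the pairs of the session order, preceded
by its length, and of a list of the pairs of the write-read relation, preceded by its length. The
two lists may be in any order. -/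
def History.Presents {n : ℕ} (h : History (Fin n)) (w : List ℕ) : Prop :=
  ∃ (S : List (Fin n × Fin n)) (R : List (Fin n × Op)),
    (∀ t₁ t₂, (t₁, t₂) ∈ S ↔ h.so t₁ t₂) ∧
    (∀ t o, (t, o) ∈ R ↔ h.wr t o) ∧
    w = n :: (List.finRange n).flatMap (fun t => (h.tr t).code)
      ++ S.length :: S.flatMap (fun p => [(p.1 : ℕ), (p.2 : ℕ)])
      ++ R.length :: R.flatMap (fun p => (p.1 : ℕ) :: p.2.code)

/-! ### Random access machines

Programs of a random access machine whose operations are addition, truncated subtraction,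
indirect reads and indirect writes, with structured control flow and a count of the steps. There is
no multiplication, so that the lengths of the numbers grow by at most a constant per step, and
polynomially many of these steps are polynomially many steps of a Turing machine. -/

namespace RAM

/-- A state: registers, and arrays of memory cells. All cells hold natural numbers. -/
structure State where
  reg : ℕ → ℕ
  arr : ℕ → ℕ → ℕ

/-- Expressions: a constant, a register, the cell of an array `a` at a computed index, a sum, and
a truncated difference. -/
inductive Expr where
  | const (c : ℕ)
  | reg (r : ℕ)
  | cell (a : ℕ) (e : Expr)
  | add (e₁ e₂ : Expr)
  | sub (e₁ e₂ : Expr)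

/-- The value of an expression. -/
def Expr.val (s : State) : Expr → ℕ
  | .const c => c
  | .reg r => s.reg r
  | .cell a e => s.arr a (e.val s)
  | .add e₁ e₂ => e₁.val s + e₂.val s
  | .sub e₁ e₂ => e₁.val s - e₂.val s

/-- The number of steps in which an expression is evaluated. -/
def Expr.cost : Expr → ℕ
  | .const _ => 1
  | .reg _ => 1
  | .cell _ e => e.cost + 1
  | .add e₁ e₂ => e₁.cost + e₂.cost + 1
  | .sub e₁ e₂ => e₁.cost + e₂.cost + 1

/-- Programs: assignment to a register, assignment to the cell of an array at a computed index,
sequence, branching and loops. A test succeeds if the value of its expression is not zero. -/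
inductive Prog where
  | assign (r : ℕ) (e : Expr)
  | store (a : ℕ) (idx e : Expr)
  | seq (p q : Prog)
  | branch (e : Expr) (p q : Prog)
  | loop (e : Expr) (p : Prog)

/-- `Runs p s m s'`: the program `p`, started in the state `s`, halts after `m` steps in the
state `s'`. -/
inductive Runs : Prog → State → ℕ → State → Prop
  | assign (r : ℕ) (e : Expr) (s : State) :
      Runs (.assign r e) s (e.cost + 1) ⟨Function.update s.reg r (e.val s), s.arr⟩
  | store (a : ℕ) (idx e : Expr) (s : State) :
      Runs (.store a idx e) s (idx.cost + e.cost + 1)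
        ⟨s.reg, Function.update s.arr a (Function.update (s.arr a) (idx.val s) (e.val s))⟩
  | seq {p q : Prog} {s s₁ s₂ : State} {m₁ m₂ : ℕ} :
      Runs p s m₁ s₁ → Runs q s₁ m₂ s₂ → Runs (.seq p q) s (m₁ + m₂) s₂
  | branch_true {e : Expr} {p q : Prog} {s s₁ : State} {m : ℕ} :
      e.val s ≠ 0 → Runs p s m s₁ → Runs (.branch e p q) s (e.cost + 1 + m) s₁
  | branch_false {e : Expr} {p q : Prog} {s s₁ : State} {m : ℕ} :
      e.val s = 0 → Runs q s m s₁ → Runs (.branch e p q) s (e.cost + 1 + m) s₁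
  | loop_step {e : Expr} {p : Prog} {s s₁ s₂ : State} {m₁ m₂ : ℕ} :
      e.val s ≠ 0 → Runs p s m₁ s₁ → Runs (.loop e p) s₁ m₂ s₂ →
        Runs (.loop e p) s (e.cost + 1 + m₁ + m₂) s₂
  | loop_exit {e : Expr} {p : Prog} {s : State} :
      e.val s = 0 → Runs (.loop e p) s (e.cost + 1) s

/-- Runs are deterministic: the final state and the number of steps are determined. -/
theorem Runs.unique {p : Prog} {s s₁ s₂ : State} {m₁ m₂ : ℕ}
    (h₁ : Runs p s m₁ s₁) (h₂ : Runs p s m₂ s₂) : m₁ = m₂ ∧ s₁ = s₂ := by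
  induction h₁ generalizing m₂ s₂ with
  | assign => cases h₂; exact ⟨rfl, rfl⟩
  | store => cases h₂; exact ⟨rfl, rfl⟩
  | seq _ _ ih₁ ih₂ =>
    cases h₂ with
    | seq a b =>
      obtain ⟨rfl, rfl⟩ := ih₁ a
      obtain ⟨rfl, rfl⟩ := ih₂ b
      exact ⟨rfl, rfl⟩
  | branch_true h _ ih =>
    cases h₂ with
    | branch_true _ b => obtain ⟨rfl, rfl⟩ := ih b; exact ⟨rfl, rfl⟩
    | branch_false h' _ => exact absurd h' h
  | branch_false h _ ih =>
    cases h₂ with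
    | branch_true h' _ => exact absurd h h'
    | branch_false _ b => obtain ⟨rfl, rfl⟩ := ih b; exact ⟨rfl, rfl⟩
  | loop_step h _ _ ih₁ ih₂ =>
    cases h₂ with
    | loop_step _ a b =>
      obtain ⟨rfl, rfl⟩ := ih₁ a
      obtain ⟨rfl, rfl⟩ := ih₂ b
      exact ⟨rfl, rfl⟩
    | loop_exit h' => exact absurd h' h
  | loop_exit h =>
    cases h₂ with
    | loop_step h' _ _ => exact absurd h h'
    | loop_exit _ => exact ⟨rfl, rfl⟩

/-- The initial state on the input `w`: array `0` holds the entries of `w`, register `0` holds the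
length of `w`, and everything else is zero. -/
def start (w : List ℕ) : State where
  reg := fun r => if r = 0 then w.length else 0
  arr := fun a i => if a = 0 then w.getD i 0 else 0

/-- On the input `w` the program `p` halts within `m` steps, and its answer, found in
register `0`, is `1` if `P` holds and `0` otherwise. -/
def Answers (p : Prog) (w : List ℕ) (m : ℕ) (P : Prop) : Prop :=
  ∃ (m' : ℕ) (s : State), m' ≤ m ∧ Runs p (start w) m' s ∧
    ((P ∧ s.reg 0 = 1) ∨ (¬ P ∧ s.reg 0 = 0))

end RAM

/-! ### Prefix consistency as reachability between sets of committed transactions -/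

namespace History

/-! A commit order is read as a process that commits one transaction at a time. Suppose `t` comes
right after the set `P`. A transaction `t₄` outside `P` satisfies (`t`, `t₄`) ∈ `co*`, so the axiom
`Prefix` forbids `t` exactly when `t` writes some `x`, a transaction `t₃` reads `x` from a member of
`P`, and `t₃` has a direct dependency outside `P`. This condition, together with the presence in `P`
of all dependencies of `t`, mentions only the set `P` and not the order inside it. Hence prefix
consistency is reachability of the full set from the empty set in a graph on sets of transactions
(`prefixConsistent_iff_committable`).

Every reachable set is closed under session predecessors, so it is determined by its maximal
elements. These form an antichain, hence there are at most `k` of them, and at most `(n + 1) ^ k`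
sets are reachable (`card_le_of_soClosed`). An exhaustive search of the reachable sets is therefore
polynomial for fixed `k`.

On the machine a set is a number below `2 ^ n`, its binary mask. Masks index an array of visited
sets, so the membership test is one memory access. Powers of two come from repeated doubling and
binary digits from greedy subtraction, so no multiplication is needed. Which transactions can be
committed next is found by scans of tables of the operations and of the session order
(`ends_check`). The search (`ends_search`) keeps a queue without repetitions whose entries are all
reachable; the count of reachable sets bounds its iterations, and when the queue is exhausted it
contains every reachable set.

Correctness and running time are proved together by Hoare-style rules for `Ends`. A syntactic frame
rule carries over whatever a program does not write. -/

/-- `b` depends directly on `a`: it reads from `a` or follows `a` in the session order. -/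
def Dep {T : Type*} (h : History T) (a b : T) : Prop :=
  h.Wr a b ∨ h.so a b

/-- The transaction `t` may be committed right after the transactions of `P`. -/
def CanCommit {T : Type*} (h : History T) (P : Set T) (t : T) : Prop :=
  t ∉ P ∧ (∀ a, h.Dep a t → a ∈ P) ∧
    ∀ x t₁ t₃ t₄, (h.tr t).Writes x → t₁ ∈ P → h.WrVar x t₁ t₃ → h.Dep t₄ t₃ → t₄ ∈ P

/-- The sets of transactions that can be committed one transaction at a time. -/
def Committable {T : Type*} (h : History T) : Set T → Prop :=
  Relation.ReflTransGen (fun P Q => ∃ t, h.CanCommit P t ∧ Q = insert t P) ∅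

/-- Induction on the size of an initial segment of `co`: its greatest element `t` is committed last,
and what remains is exactly the set of `co`-predecessors of `t`, again an initial segment. -/
theorem committable_of_lowerSet {T : Type*} [Finite T] (h : History T) {co : T → T → Prop}
    (hco : IsStrictTotalOrder T co) (hdep : ∀ t₁ t₂, h.Wr t₁ t₂ ∨ h.so t₁ t₂ → co t₁ t₂)
    (hpre : h.PrefixAxiom co) (m : ℕ) (P : Set T) (hm : P.ncard = m)
    (hP : ∀ a b, b ∈ P → co a b → a ∈ P) : h.Committable P := by
  induction m generalizing P with
  | zero =>
    rw [(Set.ncard_eq_zero (Set.toFinite P)).1 hm]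
    exact .refl
  | succ m ih =>
    have hne : P.Nonempty := (Set.ncard_pos (Set.toFinite P)).1 (by omega)
    have hirr : ∀ a, ¬ co a a := hco.toIrrefl.irrefl
    have htr : ∀ a b c, co a b → co b c → co a c := hco.toIsTrans.trans
    have htri : ∀ a b, co a b ∨ a = b ∨ co b a := by
      intro a b
      by_contra hc
      push Not at hc
      exact hc.2.1 (hco.toTrichotomous.trichotomous a b hc.1 hc.2.2)
    have : IsTrans T (Function.swap co) := ⟨fun a b c h₁ h₂ => htr _ _ _ h₂ h₁⟩
    have : Std.Irrefl (Function.swap co) := ⟨fun a h₁ => hirr a h₁⟩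
    -- A minimum for the reversed order is the `co`-greatest element of `P`.
    obtain ⟨t, htP, hmax⟩ :=
      (Finite.wellFounded_of_trans_of_irrefl (Function.swap co)).has_min P hne
    have hmem : ∀ s, s ∈ P \ {t} ↔ co s t := by
      intro s
      constructor
      · rintro ⟨hs, hst⟩
        rcases htri s t with h₁ | h₁ | h₁
        · exact h₁
        · exact absurd h₁ hst
        · exact absurd h₁ (hmax s hs)
      · intro hs
        exact ⟨hP s t htP hs, by rintro rfl; exact hirr _ hs⟩
    have hins : P = insert t (P \ {t}) := by
      rw [Set.insert_sdiff_singleton, Set.insert_eq_of_mem htP]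
    refine Relation.ReflTransGen.tail (ih (P \ {t}) ?_ ?_) ⟨t, ⟨?_, ?_, ?_⟩, hins⟩
    · have := Set.ncard_sdiff_singleton_add_one htP (Set.toFinite P)
      omega
    · intro a b hb hab
      rw [hmem] at hb ⊢
      exact htr _ _ _ hab hb
    · simp
    · intro a ha
      exact (hmem a).2 (hdep a t ha)
    · intro x t₁ t₃ t₄ hw h₁ hwr hd
      rw [hmem] at h₁ ⊢
      by_contra hc
      -- If `t₄` does not precede `t`, then `t` reaches `t₄` by `co*`, and `Prefix` puts `t` before
      -- `t₁`, which was committed earlier.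
      have h₂ : co t t₁ := by
        refine hpre x t₁ t t₃ (by rintro rfl; exact hirr _ h₁) hwr hw ⟨t₄, ?_, hd⟩
        rcases htri t₄ t with h₃ | h₃ | h₃
        · exact absurd h₃ hc
        · exact h₃ ▸ .refl
        · exact .single h₃
      exact hirr _ (htr _ _ _ h₁ h₂)

/-- The rank is the time of commitment and `c` is the next unused time. Ordering by rank recovers a
commit order from a path of sets. -/
theorem Committable.exists_rank {T : Type*} {h : History T} {P : Set T} (hP : h.Committable P) :
    ∃ (f : T → ℕ) (c : ℕ), (∀ a ∈ P, f a < c) ∧ Set.InjOn f P ∧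
      ∀ t ∈ P, h.CanCommit {s | s ∈ P ∧ f s < f t} t := by
  classical
  induction hP with
  | refl => exact ⟨fun _ => 0, 0, by simp, by simp, by simp⟩
  | @tail P Q _ hstep ih =>
    obtain ⟨f, c, hc, hinj, hcan⟩ := ih
    obtain ⟨t, ht, rfl⟩ := hstep
    have hne : ∀ a ∈ P, a ≠ t := by rintro a ha rfl; exact ht.1 ha
    have hold : ∀ a ∈ P, Function.update f t c a = f a := fun a ha => by simp [hne a ha]
    refine ⟨Function.update f t c, c + 1, ?_, ?_, ?_⟩
    · rintro a (rfl | ha)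
      · simp
      · rw [hold a ha]; exact (hc a ha).trans (Nat.lt_succ_self c)
    · rintro a (rfl | ha) b (rfl | hb) hab
      · rfl
      · rw [hold b hb, Function.update_self] at hab
        exact absurd (hc b hb) (by omega)
      · rw [hold a ha, Function.update_self] at hab
        exact absurd (hc a ha) (by omega)
      · rw [hold a ha, hold b hb] at hab
        exact hinj ha hb hab
    · rintro a (rfl | ha)
      -- All earlier ranks are below `c`, so the elements ranked below the new one are exactly the
      -- old set `P`.
      · convert ht using 1
        ext s
        simp only [Set.mem_insert_iff, Set.mem_ofPred_eq, Function.update_self]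
        constructor
        · rintro ⟨rfl | hs, h₁⟩
          · simp at h₁
          · exact hs
        · intro hs
          exact ⟨.inr hs, by rw [hold s hs]; exact hc s hs⟩
      · convert hcan a ha using 1
        ext s
        simp only [Set.mem_insert_iff, Set.mem_ofPred_eq, hold a ha]
        constructor
        · rintro ⟨rfl | hs, h₁⟩
          · rw [Function.update_self] at h₁
            exact absurd (hc a ha) (by omega)
          · exact ⟨hs, by rwa [hold s hs] at h₁⟩
        · rintro ⟨hs, h₁⟩
          exact ⟨.inr hs, by rwa [hold s hs]⟩

theorem prefixConsistent_of_committable {T : Type*} {h : History T}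
    (hP : h.Committable Set.univ) : h.PrefixConsistent := by
  obtain ⟨f, c, -, hinj, hcan⟩ := hP.exists_rank
  simp only [Set.mem_univ, true_and, forall_const] at hcan
  have hstrict : IsStrictTotalOrder T (fun a b => f a < f b) :=
    { irrefl := fun a => lt_irrefl (f a)
      trans := fun a b c h₁ h₂ => lt_trans h₁ h₂
      trichotomous := fun a b h₁ h₂ => hinj (Set.mem_univ a) (Set.mem_univ b) (by omega) }
  refine ⟨fun a b => f a < f b, hstrict, fun a b hab => (hcan b).2.1 a hab, ?_⟩
  rintro x t₁ t₂ t₃ hne hwr hw ⟨t₄, hco, hd⟩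
  have hle : f t₂ ≤ f t₄ := by
    clear hd
    induction hco with
    | refl => exact le_rfl
    | tail _ h₁ ih => exact ih.trans (le_of_lt h₁)
  by_contra hlt
  have hne' : f t₁ ≠ f t₂ := fun he => hne (hinj (Set.mem_univ _) (Set.mem_univ _) he)
  -- If `t₁` were earlier than `t₂`, the last clause of `CanCommit` for `t₂` would make `t₄` earlier
  -- than `t₂`, against `hle`.
  have h₁ : f t₄ < f t₂ := (hcan t₂).2.2 x t₁ t₃ t₄ hw (show f t₁ < f t₂ by omega) hwr hd
  omega

theorem prefixConsistent_iff_committable {T : Type*} [Finite T] (h : History T) :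
    h.PrefixConsistent ↔ h.Committable Set.univ := by
  refine ⟨?_, prefixConsistent_of_committable⟩
  rintro ⟨co, hco, hdep, hpre⟩
  exact h.committable_of_lowerSet hco hdep hpre _ _ rfl fun _ _ _ _ => Set.mem_univ _

/-! ### Counting sets closed under the session order -/

/-- The set is closed under predecessors in the session order. -/
def SoClosed {T : Type*} (h : History T) (P : Set T) : Prop :=
  ∀ a b, b ∈ P → h.so a b → a ∈ P

theorem Committable.soClosed {T : Type*} {h : History T} {P : Set T} (hP : h.Committable P) :
    h.SoClosed P := by
  induction hP with
  | refl => exact fun a b hb => absurd hb (Set.notMem_empty b)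
  | tail _ hstep ih =>
    obtain ⟨t, ht, rfl⟩ := hstep
    rintro a b (rfl | hb) hab
    · exact .inr (ht.2.1 a (.inr hab))
    · exact .inr (ih a b hb hab)

open Classical in
/-- The transactions of `P` that precede no transaction of `P` in the session order. -/
noncomputable def soMaximal {T : Type*} [Fintype T] (h : History T) (P : Set T) : Finset T :=
  Finset.univ.filter fun t => t ∈ P ∧ ∀ s ∈ P, ¬ h.so t s

theorem soMaximal_card_le_width {T : Type*} [Fintype T] (h : History T) (P : Set T) :
    (h.soMaximal P).card ≤ h.width := by
  classical
  unfold width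
  refine Finset.le_sup (f := Finset.card) (Finset.mem_filter.2 ⟨Finset.mem_univ _, ?_⟩)
  intro a ha b hb _ hab
  simp only [soMaximal, Finset.coe_filter, Finset.mem_univ, true_and, Set.mem_ofPred_eq] at ha hb
  exact ha.2 b hb.1 hab

/-- By finiteness every element lies below a maximal one, so a closed set is recovered from its
maximal elements. -/
theorem SoClosed.mem_iff {T : Type*} [Fintype T] {h : History T} {P : Set T} (hP : h.SoClosed P)
    (a : T) : a ∈ P ↔ ∃ t ∈ h.soMaximal P, a = t ∨ h.so a t := by
  constructor
  · intro ha
    have : IsTrans T (Function.swap h.so) := ⟨fun a b c h₁ h₂ => h.so_trans _ _ _ h₂ h₁⟩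
    have : Std.Irrefl (Function.swap h.so) := ⟨fun a h₁ => h.so_irrefl a h₁⟩
    obtain ⟨t, ⟨htP, hat⟩, hmax⟩ :=
      (Finite.wellFounded_of_trans_of_irrefl (Function.swap h.so)).has_min
        {t | t ∈ P ∧ (a = t ∨ h.so a t)} ⟨a, ha, .inl rfl⟩
    refine ⟨t, ?_, hat⟩
    simp only [soMaximal, Finset.mem_filter, Finset.mem_univ, true_and]
    refine ⟨htP, fun s hs hts => hmax s ⟨hs, .inr ?_⟩ hts⟩
    rcases hat with rfl | hat
    · exact hts
    · exact h.so_trans _ _ _ hat hts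
  · rintro ⟨t, ht, hat⟩
    simp only [soMaximal, Finset.mem_filter, Finset.mem_univ, true_and] at ht
    rcases hat with rfl | hat
    · exact ht.1
    · exact hP a t ht.1 hat

/-- A finite family of distinct closed sets has at most `(|T| + 1) ^ k` members if the width of the
history is at most `k`. -/
theorem card_le_of_soClosed {T ι : Type*} [Fintype T] (h : History T) {k : ℕ} (hk : h.width ≤ k)
    (A : Finset ι) (F : ι → Set T) (hinj : Set.InjOn F A) (hF : ∀ i ∈ A, h.SoClosed (F i)) :
    A.card ≤ (Fintype.card T + 1) ^ k := by
  classical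
  have hcard : Fintype.card (Fin k → Option T) = (Fintype.card T + 1) ^ k := by simp
  rw [← hcard]
  -- A closed set is encoded by the list of its maximal elements, padded with `none` to length `k`.
  -- The width bound ensures that no list is truncated, which gives injectivity.
  refine Finset.card_le_card_of_injOn
    (fun i (j : Fin k) => (h.soMaximal (F i)).toList[(j : ℕ)]?) (fun _ _ => Finset.mem_univ _) ?_
  intro i hi j hj hij
  apply hinj hi hj
  have hlist : (h.soMaximal (F i)).toList = (h.soMaximal (F j)).toList := by
    apply List.ext_getElem?
    intro c
    by_cases hc : c < k
    · exact congrFun hij ⟨c, hc⟩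
    · have := h.soMaximal_card_le_width (F i)
      have := h.soMaximal_card_le_width (F j)
      rw [List.getElem?_eq_none, List.getElem?_eq_none] <;> rw [Finset.length_toList] <;> omega
  have hmax : h.soMaximal (F i) = h.soMaximal (F j) := by
    ext t
    rw [← Finset.mem_toList, hlist, Finset.mem_toList]
  ext a
  rw [(hF i hi).mem_iff, (hF j hj).mem_iff, hmax]

/-! ### Sets of transactions as numbers -/

/-- The set of transactions whose indices are the positions of the ones in the binary expansion. -/
def ofMask {n : ℕ} (m : ℕ) : Set (Fin n) :=
  {t | m.testBit t = true}

theorem mem_ofMask {n m : ℕ} {t : Fin n} : t ∈ ofMask m ↔ m.testBit t = true :=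
  Iff.rfl

theorem _root_.Nat.mod_two_pow_succ_eq (m t : ℕ) :
    m % 2 ^ (t + 1) = m % 2 ^ t + 2 ^ t * (m.testBit t).toNat := by
  rw [Nat.mod_pow_succ, Nat.toNat_testBit]

/-- Digit `t` is zero, so the addition produces no carry and changes only that digit. This lets a
plain sum represent the insertion of an element. -/
theorem _root_.Nat.testBit_add_two_pow {m t : ℕ} (ht : m.testBit t = false) (i : ℕ) :
    (m + 2 ^ t).testBit i = (m.testBit i || decide (t = i)) := by
  rcases lt_trichotomy i t with hi | rfl | hi
  · rw [Nat.add_comm, Nat.testBit_two_pow_add_gt hi]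
    simp [hi.ne']
  · rw [Nat.add_comm, Nat.testBit_two_pow_add_eq]
    simp [ht]
  · obtain ⟨j, rfl⟩ := Nat.exists_eq_add_of_lt hi
    have hmod : m % 2 ^ (t + 1) = m % 2 ^ t := by
      rw [Nat.mod_two_pow_succ_eq, ht]; simp
    have hlt : m % 2 ^ t < 2 ^ t := Nat.mod_lt _ (by positivity)
    have hpow : 2 ^ t % 2 ^ (t + 1) = 2 ^ t :=
      Nat.mod_eq_of_lt (Nat.pow_lt_pow_right (by norm_num) (by omega))
    -- The lowest `t + 1` digits of the sum stay below `2 ^ (t + 1)`, so the quotient, which holds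
    -- the higher digits, is unchanged.
    have hdiv : (m + 2 ^ t) / 2 ^ (t + 1) = m / 2 ^ (t + 1) := by
      rw [Nat.add_div_eq_of_add_mod_lt (by rw [hmod, hpow, pow_succ]; omega),
        Nat.div_eq_of_lt (Nat.pow_lt_pow_right (by norm_num) (by omega)), Nat.add_zero]
    rw [show t + j + 1 = j + (t + 1) by omega, Nat.testBit_add, Nat.testBit_add, hdiv]
    simp [show t ≠ j + (t + 1) by omega]

theorem ofMask_add_two_pow {n m : ℕ} {t : Fin n} (ht : t ∉ (ofMask m : Set (Fin n))) :
    (ofMask (m + 2 ^ (t : ℕ)) : Set (Fin n)) = insert t (ofMask m) := by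
  rw [mem_ofMask, Bool.not_eq_true] at ht
  ext s
  rw [mem_ofMask, Nat.testBit_add_two_pow ht, Set.mem_insert_iff, mem_ofMask]
  simp only [Bool.or_eq_true, decide_eq_true_eq, Fin.ext_iff]
  rw [or_comm, eq_comm]

theorem ofMask_injOn (n : ℕ) : Set.InjOn (ofMask : ℕ → Set (Fin n)) {m | m < 2 ^ n} := by
  intro a ha b hb hab
  apply Nat.eq_of_testBit_eq
  intro i
  by_cases hi : i < n
  · have := congrArg (fun P : Set (Fin n) => (⟨i, hi⟩ : Fin n) ∈ P) hab
    simpa only [mem_ofMask, eq_iff_iff, Bool.coe_iff_coe] using this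
  · have hpow : 2 ^ n ≤ 2 ^ i := Nat.pow_le_pow_right (by norm_num) (by omega)
    rw [Nat.testBit_lt_two_pow (lt_of_lt_of_le ha hpow),
      Nat.testBit_lt_two_pow (lt_of_lt_of_le hb hpow)]

/-- One more transaction is committed, for sets of transactions given as numbers. -/
def MaskStep {n : ℕ} (h : History (Fin n)) (m m' : ℕ) : Prop :=
  ∃ t : Fin n, h.CanCommit (ofMask m) t ∧ m' = m + 2 ^ (t : ℕ)

/-- The numbers of the sets that can be committed. -/
def MaskReach {n : ℕ} (h : History (Fin n)) : ℕ → Prop :=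
  Relation.ReflTransGen h.MaskStep 0

theorem ofMask_zero (n : ℕ) : (ofMask 0 : Set (Fin n)) = ∅ := by
  ext t; simp [mem_ofMask]

theorem MaskReach.lt_and_committable {n m : ℕ} {h : History (Fin n)} (hm : h.MaskReach m) :
    m < 2 ^ n ∧ h.Committable (ofMask m) := by
  induction hm with
  | refl => exact ⟨by positivity, by rw [ofMask_zero]; exact .refl⟩
  | @tail m m' _ hstep ih =>
    obtain ⟨t, ht, rfl⟩ := hstep
    refine ⟨?_, ih.2.tail ⟨t, ht, ofMask_add_two_pow ht.1⟩⟩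
    apply Nat.lt_pow_two_of_testBit
    intro i hi
    have hpow : 2 ^ n ≤ 2 ^ i := Nat.pow_le_pow_right (by norm_num) (by omega)
    rw [Nat.testBit_add_two_pow (by simpa [mem_ofMask] using ht.1),
      Nat.testBit_lt_two_pow (lt_of_lt_of_le ih.1 hpow)]
    have := t.isLt
    simp; omega

theorem Committable.exists_mask {n : ℕ} {P : Set (Fin n)} {h : History (Fin n)}
    (hP : h.Committable P) : ∃ m, h.MaskReach m ∧ ofMask m = P := by
  induction hP with
  | refl => exact ⟨0, .refl, ofMask_zero n⟩
  | tail _ hstep ih =>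
    obtain ⟨t, ht, rfl⟩ := hstep
    obtain ⟨m, hm, rfl⟩ := ih
    exact ⟨m + 2 ^ (t : ℕ), hm.tail ⟨t, ht, rfl⟩, ofMask_add_two_pow ht.1⟩

theorem prefixConsistent_iff_maskReach {n : ℕ} (h : History (Fin n)) :
    h.PrefixConsistent ↔ h.MaskReach (2 ^ n - 1) := by
  have huniv : (ofMask (2 ^ n - 1) : Set (Fin n)) = Set.univ := by
    ext t; simp [mem_ofMask]
  rw [prefixConsistent_iff_committable]
  constructor
  · intro hP
    obtain ⟨m, hm, hmP⟩ := hP.exists_mask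
    have hpos : 0 < 2 ^ n := by positivity
    have : m = 2 ^ n - 1 :=
      ofMask_injOn n hm.lt_and_committable.1 (show 2 ^ n - 1 < 2 ^ n by omega)
        (hmP.trans huniv.symm)
    exact this ▸ hm
  · intro hm
    exact huniv ▸ hm.lt_and_committable.2

/-- Applied to the search queue, this bounds the number of iterations of the search. -/
theorem length_le_of_maskReach {n k : ℕ} (h : History (Fin n)) (hk : h.width ≤ k) (q : List ℕ)
    (hq : q.Nodup) (hr : ∀ m ∈ q, h.MaskReach m) : q.length ≤ (n + 1) ^ k := by
  rw [← List.toFinset_card_of_nodup hq]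
  have := h.card_le_of_soClosed hk q.toFinset ofMask
    ((ofMask_injOn n).mono fun m hm => (hr m (by simpa using hm)).lt_and_committable.1)
    fun m hm => (hr m (by simpa using hm)).lt_and_committable.2.soClosed
  simpa using this

end History

/-! ### Reasoning about runs of programs -/

namespace RAM

/-- Started in the state `s`, the program halts within `m` steps in a state that satisfies `Q`. -/
def Ends (p : Prog) (s : State) (m : ℕ) (Q : State → Prop) : Prop :=
  ∃ m' s', m' ≤ m ∧ Runs p s m' s' ∧ Q s'

/-- The program contains an assignment to the register `r`. -/
def Prog.writesReg : Prog → ℕ → Bool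
  | .assign r _, r' => r == r'
  | .store _ _ _, _ => false
  | .seq p q, r => p.writesReg r || q.writesReg r
  | .branch _ p q, r => p.writesReg r || q.writesReg r
  | .loop _ p, r => p.writesReg r

/-- The program contains an assignment to a cell of the array `a`. -/
def Prog.writesArr : Prog → ℕ → Bool
  | .assign _ _, _ => false
  | .store a _ _, a' => a == a'
  | .seq p q, a => p.writesArr a || q.writesArr a
  | .branch _ p q, a => p.writesArr a || q.writesArr a
  | .loop _ p, a => p.writesArr a

/-- The two states agree on all that the program does not write. -/
def Prog.Frame (p : Prog) (s s' : State) : Prop :=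
  (∀ r, p.writesReg r = false → s'.reg r = s.reg r) ∧
    ∀ a, p.writesArr a = false → s'.arr a = s.arr a

theorem Prog.Frame.refl (p : Prog) (s : State) : p.Frame s s :=
  ⟨fun _ _ => rfl, fun _ _ => rfl⟩

theorem Prog.Frame.trans {p : Prog} {s₁ s₂ s₃ : State} (h₁ : p.Frame s₁ s₂) (h₂ : p.Frame s₂ s₃) :
    p.Frame s₁ s₃ :=
  ⟨fun r hr => (h₂.1 r hr).trans (h₁.1 r hr), fun a ha => (h₂.2 a ha).trans (h₁.2 a ha)⟩

theorem Prog.Frame.weaken {p q : Prog} {s s' : State} (h : p.Frame s s')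
    (hr : ∀ r, q.writesReg r = false → p.writesReg r = false)
    (ha : ∀ a, q.writesArr a = false → p.writesArr a = false) : q.Frame s s' :=
  ⟨fun r h₁ => h.1 r (hr r h₁), fun a h₁ => h.2 a (ha a h₁)⟩

/-- `writesReg` and `writesArr` are computable, so for a concrete program the side conditions of
this frame rule are closed by `rfl`. -/
theorem Runs.frame {p : Prog} {s s' : State} {m : ℕ} (h : Runs p s m s') : p.Frame s s' := by
  induction h with
  | assign r e s =>
    refine ⟨fun r' hr => ?_, fun _ _ => rfl⟩
    have : r ≠ r' := by simpa [Prog.writesReg] using hr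
    simp [this.symm]
  | store a idx e s =>
    refine ⟨fun _ _ => rfl, fun a' ha => ?_⟩
    have : a ≠ a' := by simpa [Prog.writesArr] using ha
    simp [this.symm]
  | seq _ _ ih₁ ih₂ =>
    exact (ih₁.weaken (by simp +contextual [Prog.writesReg])
      (by simp +contextual [Prog.writesArr])).trans
      (ih₂.weaken (by simp +contextual [Prog.writesReg]) (by simp +contextual [Prog.writesArr]))
  | branch_true _ _ ih =>
    exact ih.weaken (by simp +contextual [Prog.writesReg]) (by simp +contextual [Prog.writesArr])
  | branch_false _ _ ih =>
    exact ih.weaken (by simp +contextual [Prog.writesReg]) (by simp +contextual [Prog.writesArr])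
  | loop_step _ _ _ ih₁ ih₂ =>
    exact (ih₁.weaken (by simp +contextual [Prog.writesReg])
      (by simp +contextual [Prog.writesArr])).trans ih₂
  | loop_exit _ => exact .refl _ _

theorem Ends.mono {p : Prog} {s : State} {m m' : ℕ} {Q Q' : State → Prop} (h : Ends p s m Q)
    (hm : m ≤ m') (hQ : ∀ s', p.Frame s s' → Q s' → Q' s') : Ends p s m' Q' := by
  obtain ⟨c, s', hc, hr, hs⟩ := h
  exact ⟨c, s', hc.trans hm, hr, hQ s' hr.frame hs⟩

theorem Ends.seq {p q : Prog} {s : State} {m₁ m₂ : ℕ} {Q₁ Q : State → Prop} (h₁ : Ends p s m₁ Q₁)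
    (h₂ : ∀ s', p.Frame s s' → Q₁ s' → Ends q s' m₂ Q) : Ends (.seq p q) s (m₁ + m₂) Q := by
  obtain ⟨c₁, s₁, hc₁, hr₁, hs₁⟩ := h₁
  obtain ⟨c₂, s₂, hc₂, hr₂, hs₂⟩ := h₂ s₁ hr₁.frame hs₁
  exact ⟨c₁ + c₂, s₂, by omega, .seq hr₁ hr₂, hs₂⟩

theorem Ends.branch {e : Expr} {p q : Prog} {s : State} {m : ℕ} {Q : State → Prop}
    (ht : e.val s ≠ 0 → Ends p s m Q) (hf : e.val s = 0 → Ends q s m Q) :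
    Ends (.branch e p q) s (e.cost + 1 + m) Q := by
  by_cases he : e.val s = 0
  · obtain ⟨c, s', hc, hr, hs⟩ := hf he
    exact ⟨_, s', by omega, .branch_false he hr, hs⟩
  · obtain ⟨c, s', hc, hr, hs⟩ := ht he
    exact ⟨_, s', by omega, .branch_true he hr, hs⟩

/-- The program has no loops. -/
def Prog.straight : Prog → Bool
  | .assign _ _ => true
  | .store _ _ _ => true
  | .seq p q => p.straight && q.straight
  | .branch _ p q => p.straight && q.straight
  | .loop _ _ => false

/-- The final state of a program without loops. -/
def Prog.final : Prog → State → State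
  | .assign r e, s => ⟨Function.update s.reg r (e.val s), s.arr⟩
  | .store a idx e, s =>
      ⟨s.reg, Function.update s.arr a (Function.update (s.arr a) (idx.val s) (e.val s))⟩
  | .seq p q, s => q.final (p.final s)
  | .branch e p q, s => if e.val s = 0 then q.final s else p.final s
  | .loop _ _, s => s

/-- A bound for the number of steps of a program without loops. -/
def Prog.steps : Prog → ℕ
  | .assign _ e => e.cost + 1
  | .store _ idx e => idx.cost + e.cost + 1
  | .seq p q => p.steps + q.steps
  | .branch e p q => e.cost + 1 + (p.steps + q.steps)
  | .loop _ _ => 0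

/-- For loop-free programs the final state is computed by `final`, so postconditions unfold
definitionally. `steps` counts both sides of a branch, which is enough for an upper bound. -/
theorem Ends.of_straight {p : Prog} {s : State} {m : ℕ} {Q : State → Prop}
    (hp : p.straight = true) (hm : p.steps ≤ m) (hQ : Q (p.final s)) : Ends p s m Q := by
  suffices h : ∃ m' ≤ p.steps, Runs p s m' (p.final s) by
    obtain ⟨m', hm', hr⟩ := h
    exact ⟨m', _, hm'.trans hm, hr, hQ⟩
  clear hQ hm
  induction p generalizing s with
  | assign r e => exact ⟨_, le_rfl, .assign r e s⟩
  | store a idx e => exact ⟨_, le_rfl, .store a idx e s⟩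
  | seq p q ihp ihq =>
    simp only [Prog.straight, Bool.and_eq_true] at hp
    obtain ⟨m₁, h₁, r₁⟩ := ihp (s := s) hp.1
    obtain ⟨m₂, h₂, r₂⟩ := ihq (s := p.final s) hp.2
    exact ⟨m₁ + m₂, Nat.add_le_add h₁ h₂, .seq r₁ r₂⟩
  | branch e p q ihp ihq =>
    simp only [Prog.straight, Bool.and_eq_true] at hp
    by_cases he : e.val s = 0
    · obtain ⟨m₁, h₁, r₁⟩ := ihq (s := s) hp.2
      refine ⟨e.cost + 1 + m₁, by simp only [Prog.steps]; omega, ?_⟩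
      simp only [Prog.final, if_pos he]
      exact .branch_false he r₁
    · obtain ⟨m₁, h₁, r₁⟩ := ihp (s := s) hp.1
      refine ⟨e.cost + 1 + m₁, by simp only [Prog.steps]; omega, ?_⟩
      simp only [Prog.final, if_neg he]
      exact .branch_true he r₁
  | loop e p _ => simp [Prog.straight] at hp

/-- `I i` is the invariant after `i` iterations. Induction on the number `B - i` of iterations still
allowed; the extra unit in `B + 1` pays for the final failing test. -/
theorem Ends.loop {e : Expr} {p : Prog} {s : State} {c B : ℕ} {Q : State → Prop}
    (I : ℕ → State → Prop) (h0 : I 0 s)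
    (hstep : ∀ i s', I i s' → e.val s' ≠ 0 → i < B ∧ Ends p s' c (I (i + 1)))
    (hQ : ∀ i s', I i s' → e.val s' = 0 → Q s') :
    Ends (.loop e p) s ((B + 1) * (c + e.cost + 1)) Q := by
  suffices h : ∀ d i s', B - i = d → I i s' →
      Ends (.loop e p) s' ((d + 1) * (c + e.cost + 1)) Q from h B 0 s rfl h0
  intro d
  induction d with
  | zero =>
    intro i s' hd hI
    by_cases he : e.val s' = 0
    · exact ⟨_, s', by omega, .loop_exit he, hQ i s' hI he⟩
    · exact absurd (hstep i s' hI he).1 (by omega)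
  | succ d ih =>
    intro i s' hd hI
    by_cases he : e.val s' = 0
    · exact ⟨_, s', by nlinarith, .loop_exit he, hQ i s' hI he⟩
    · obtain ⟨hi, m₁, s₁, hm₁, hr₁, hI₁⟩ := hstep i s' hI he
      obtain ⟨m₂, s₂, hm₂, hr₂, hs₂⟩ := ih (i + 1) s₁ (by omega) hI₁
      refine ⟨_, s₂, ?_, .loop_step he hr₁ hr₂, hs₂⟩
      rw [Nat.succ_mul]
      omega

/-- The loop that runs `p` with the register `r` equal to `0, 1, …`, up to the value of `e`. -/
def Prog.count (r : ℕ) (e : Expr) (p : Prog) : Prog :=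
  .seq (.assign r (.const 0))
    (.loop (.sub e (.reg r)) (.seq p (.assign r (.add (.reg r) (.const 1)))))

/-- The increment follows the body, so the body must establish `I (i + 1)` in the state whose
counter is already updated. Increment, test and initialization are absorbed in the constant `10`.
The bound `L` on the iteration count lets all costs be expressed through the input length. -/
theorem Ends.count {r : ℕ} {e : Expr} {p : Prog} {s : State} {N L c m : ℕ} {Q : State → Prop}
    (I : ℕ → State → Prop) (hp : p.writesReg r = false)
    (hN : ∀ s', (Prog.count r e p).Frame s s' → e.val s' = N) (hL : N ≤ L)
    (h0 : I 0 ⟨Function.update s.reg r 0, s.arr⟩)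
    (hstep : ∀ i s', i < N → (Prog.count r e p).Frame s s' → s'.reg r = i → I i s' →
      Ends p s' c fun s'' => I (i + 1) ⟨Function.update s''.reg r (i + 1), s''.arr⟩)
    (hm : (L + 1) * (c + e.cost + 10) ≤ m)
    (hQ : ∀ s', (Prog.count r e p).Frame s s' → s'.reg r = N → I N s' → Q s') :
    Ends (Prog.count r e p) s m Q := by
  have hwr : (Prog.count r e p).writesReg r = true := by simp [Prog.count, Prog.writesReg]
  have hloop : Ends (Prog.count r e p) s (2 + (N + 1) * (c + 4 + (e.cost + 2) + 1)) Q := by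
    refine Ends.seq (Ends.of_straight rfl le_rfl rfl) ?_
    rintro s₁ - rfl
    refine Ends.loop
      (fun i s' => (Prog.count r e p).Frame s s' ∧ s'.reg r = i ∧ i ≤ N ∧ I i s') ?_ ?_ ?_
    · refine ⟨⟨fun r' hr' => ?_, fun _ _ => rfl⟩, ?_, Nat.zero_le _, h0⟩
      · have : r' ≠ r := by rintro rfl; simp [hwr] at hr'
        simp [Prog.final, this]
      · simp [Prog.final, Expr.val]
    · rintro i s' ⟨hf, hr, hi, hI⟩ he
      have hlt : i < N := by
        simp only [Expr.val, hN s' hf, hr] at he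
        omega
      refine ⟨hlt, Ends.seq (hstep i s' hlt hf hr hI) ?_⟩
      intro s'' hf' hI'
      have hr'' : s''.reg r = i := (hf'.1 r hp).trans hr
      refine Ends.of_straight rfl le_rfl ?_
      simp only [Prog.final, Expr.val, hr'']
      refine ⟨⟨fun r' hr' => ?_, fun a ha => ?_⟩, by simp, hlt, hI'⟩
      · have hne : r' ≠ r := by rintro rfl; simp [hwr] at hr'
        simp only [Function.update_of_ne hne]
        exact (hf'.1 r' (by simp_all [Prog.count, Prog.writesReg])).trans (hf.1 r' hr')
      · exact (hf'.2 a (by simpa [Prog.count, Prog.writesArr] using ha)).trans (hf.2 a ha)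
    · rintro i s' ⟨hf, hr, hi, hI⟩ he
      have : i = N := by
        simp only [Expr.val, hN s' hf, hr] at he
        omega
      subst this
      exact hQ s' hf hr hI
  refine hloop.mono (le_trans ?_ hm) fun _ _ h => h
  have : (N + 1) * (c + 4 + (e.cost + 2) + 1) ≤ (L + 1) * (c + 4 + (e.cost + 2) + 1) :=
    Nat.mul_le_mul_right _ (by omega)
  nlinarith

/-- The program that changes nothing. -/
def Prog.skip : Prog :=
  .assign 0 (.reg 0)

/-- An expression whose value is zero if the values of the two expressions are equal. -/
def Expr.ne (e₁ e₂ : Expr) : Expr :=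
  .add (.sub e₁ e₂) (.sub e₂ e₁)

theorem Expr.val_ne_eq_zero {s : State} {e₁ e₂ : Expr} :
    (Expr.ne e₁ e₂).val s = 0 ↔ e₁.val s = e₂.val s := by
  simp only [Expr.ne, Expr.val]
  omega

/-- The program that runs `p` if the value of `e` is zero. -/
def Prog.ifZero (e : Expr) (p : Prog) : Prog :=
  .branch e .skip p

end RAM

/-! ### Loading a history -/

/-- The numbers that make up the code of an operation. -/
def Op.kind : Op → ℕ
  | .read _ _ _ => 0
  | .write _ _ _ => 1

/-- The identifier of an operation. -/
def Op.ident : Op → ℕ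
  | .read i _ _ => i
  | .write i _ _ => i

/-- The variable of an operation. -/
def Op.var : Op → ℕ
  | .read _ x _ => x
  | .write _ x _ => x

/-- The value of an operation. -/
def Op.value : Op → ℕ
  | .read _ _ v => v
  | .write _ _ v => v

theorem Op.code_eq (o : Op) : o.code = [o.kind, o.ident, o.var, o.value] := by
  cases o <;> rfl

theorem Op.eq_of_fields {o o' : Op} (h₁ : o.kind = o'.kind) (h₂ : o.ident = o'.ident)
    (h₃ : o.var = o'.var) (h₄ : o.value = o'.value) : o = o' := by
  cases o <;> cases o' <;> simp_all [Op.kind, Op.ident, Op.var, Op.value]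

/-- All operations of the history, each with the index of its transaction. -/
def History.allOps {n : ℕ} (h : History (Fin n)) : List (ℕ × Op) :=
  (List.finRange n).flatMap fun t => (h.tr t).ops.map fun o => ((t : ℕ), o)

/-- Each encoded item occupies at least one entry of the input, so every parsing loop makes at most
as many iterations as the input is long. -/
theorem List.length_le_length_flatMap {α β : Type*} (f : α → List β) (hf : ∀ a, 1 ≤ (f a).length)
    (l : List α) : l.length ≤ (l.flatMap f).length := by
  induction l with
  | nil => simp
  | cons a l ih =>
    have := hf a
    simp only [List.flatMap_cons, List.length_append, List.length_cons]
    omega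

namespace RAM

open RAM.Prog RAM.Expr

/-- Array `0` holds the input, and the part of it that starts at the position given by
register `5` is `l`. -/
def Reads (w : List ℕ) (s : State) (l : List ℕ) : Prop :=
  s.arr 0 = (start w).arr 0 ∧ w.drop (s.reg 5) = l

theorem Reads.cell {w l : List ℕ} {s : State} (h : Reads w s l) (i : ℕ) :
    s.arr 0 (s.reg 5 + i) = l.getD i 0 := by
  rw [h.1, ← h.2]
  simp [start, List.getD_eq_getElem?_getD]

theorem Reads.cell_zero {w l : List ℕ} {s : State} (h : Reads w s l) :
    s.arr 0 (s.reg 5) = l.getD 0 0 :=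
  h.cell 0

theorem Reads.length_le {w l : List ℕ} {s : State} (h : Reads w s l) : l.length ≤ w.length := by
  rw [← h.2, List.length_drop]
  omega

/-- Register `2` holds the number of entries of `l`, and the arrays `1` to `5` hold the entries. -/
def OpTable (s : State) (l : List (ℕ × Op)) : Prop :=
  s.reg 2 = l.length ∧ ∀ (j : ℕ) (t : ℕ) (o : Op), l[j]? = some (t, o) →
    s.arr 1 j = t ∧ s.arr 2 j = o.kind ∧ s.arr 3 j = o.ident ∧ s.arr 4 j = o.var ∧
      s.arr 5 j = o.value

infixr:60 " ;; " => Prog.seq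

/-- Appends the operation at the current position of the input to the table of operations. -/
def parseOp : Prog :=
  store 1 (reg 2) (reg 6) ;;
  store 2 (reg 2) (cell 0 (reg 5)) ;;
  store 3 (reg 2) (cell 0 (add (reg 5) (const 1))) ;;
  store 4 (reg 2) (cell 0 (add (reg 5) (const 2))) ;;
  store 5 (reg 2) (cell 0 (add (reg 5) (const 3))) ;;
  assign 2 (add (reg 2) (const 1)) ;;
  assign 5 (add (reg 5) (const 4))

theorem ends_parseOp {w rest : List ℕ} {s : State} {l : List (ℕ × Op)} {t : ℕ} {o : Op}
    (hr : Reads w s (o.code ++ rest)) (ht : s.reg 6 = t) (hl : OpTable s l) :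
    Ends parseOp s 40 fun s' => Reads w s' rest ∧ OpTable s' (l ++ [(t, o)]) := by
  have c0 := hr.cell_zero
  have c1 := hr.cell 1
  have c2 := hr.cell 2
  have c3 := hr.cell 3
  rw [Op.code_eq] at c0 c1 c2 c3
  simp only [List.cons_append, List.nil_append, List.getD_cons_zero, List.getD_cons_succ]
    at c0 c1 c2 c3
  refine Ends.of_straight rfl (by decide) ⟨⟨hr.1, ?_⟩, ?_, ?_⟩
  · change w.drop (s.reg 5 + 4) = rest
    rw [← List.drop_drop, hr.2, Op.code_eq]
    rfl
  · change s.reg 2 + 1 = _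
    simp [hl.1]
  · intro j t' o' hj
    change Function.update (s.arr 1) (s.reg 2) (s.reg 6) j = _ ∧
      Function.update (s.arr 2) (s.reg 2) (s.arr 0 (s.reg 5)) j = _ ∧
      Function.update (s.arr 3) (s.reg 2) (s.arr 0 (s.reg 5 + 1)) j = _ ∧
      Function.update (s.arr 4) (s.reg 2) (s.arr 0 (s.reg 5 + 2)) j = _ ∧
      Function.update (s.arr 5) (s.reg 2) (s.arr 0 (s.reg 5 + 3)) j = _
    rw [c0, c1, c2, c3, ht, hl.1]
    rcases lt_trichotomy j l.length with h | h | h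
    · rw [List.getElem?_append_left h] at hj
      simpa [Function.update_of_ne h.ne] using hl.2 j t' o' hj
    · subst h
      simp only [List.getElem?_concat_length, Option.some.injEq, Prod.mk.injEq] at hj
      obtain ⟨rfl, rfl⟩ := hj
      simp
    · rw [List.getElem?_eq_none (by simp; omega)] at hj
      cases hj

/-- Loads the operations of the transaction at the current position of the input. -/
def parseTransaction : Prog :=
  (assign 9 (cell 0 (reg 5)) ;; assign 5 (add (reg 5) (const 1))) ;;
  count 7 (reg 9) parseOp

/-- Loop invariant: after `i` operations, the codes of `ops.drop i` are still unread and `ops.take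
i` has been appended to the table. The factor `51` is `40` for the body, `1` for the loop bound and
`10` from `Ends.count`. -/
theorem ends_parseTransaction {w rest : List ℕ} {s : State} {l : List (ℕ × Op)} {t : ℕ}
    {tr : Transaction} (hr : Reads w s (tr.code ++ rest)) (ht : s.reg 6 = t) (hl : OpTable s l) :
    Ends parseTransaction s (10 + (w.length + 1) * 51) fun s' =>
      Reads w s' rest ∧ OpTable s' (l ++ tr.ops.map fun o => (t, o)) := by
  have c0 : s.arr 0 (s.reg 5) = tr.ops.length := hr.cell_zero
  refine Ends.seq (Q₁ := fun s' => Reads w s' (tr.ops.flatMap Op.code ++ rest) ∧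
    s'.reg 9 = tr.ops.length ∧ s'.reg 6 = t ∧ OpTable s' l) ?_ ?_
  · refine Ends.of_straight rfl (by decide) ⟨⟨hr.1, ?_⟩, c0, ht, hl⟩
    change w.drop (s.reg 5 + 1) = _
    rw [← List.drop_drop, hr.2]
    rfl
  · rintro s₁ - ⟨hr₁, h9, h6, hl₁⟩
    refine Ends.count (N := tr.ops.length) (L := w.length) (c := 40) (fun i s' =>
      Reads w s' ((tr.ops.drop i).flatMap Op.code ++ rest) ∧
        OpTable s' (l ++ (tr.ops.take i).map fun o => (t, o))) rfl ?_ ?_ ?_ ?_ le_rfl ?_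
    · exact fun s' hf => (hf.1 9 rfl).trans h9
    · have h₁ := hr₁.length_le
      have h₂ := List.length_le_length_flatMap Op.code (fun o => by simp [Op.code_eq]) tr.ops
      rw [List.length_append] at h₁
      omega
    · exact ⟨hr₁, by rw [List.take_zero, List.map_nil, List.append_nil]; exact hl₁⟩
    · rintro i s' hi hf - ⟨hr', hl'⟩
      rw [List.drop_eq_getElem_cons hi, List.flatMap_cons, List.append_assoc] at hr'
      refine (ends_parseOp hr' ((hf.1 6 rfl).trans h6) hl').mono le_rfl ?_
      rintro s'' - ⟨h₁, h₂⟩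
      refine ⟨h₁, ?_⟩
      rw [List.take_succ_eq_append_getElem hi, List.map_append, ← List.append_assoc]
      exact h₂
    · rintro s' - - ⟨h₁, h₂⟩
      rw [List.drop_length] at h₁
      rw [List.take_length] at h₂
      exact ⟨h₁, h₂⟩

/-- Loads all transactions. -/
def parseTransactions : Prog :=
  count 6 (reg 1) parseTransaction

theorem ends_parseTransactions {n : ℕ} (h : History (Fin n)) {w rest : List ℕ} {s : State}
    (hr : Reads w s (((List.finRange n).flatMap fun t => (h.tr t).code) ++ rest))
    (h1 : s.reg 1 = n) (h2 : s.reg 2 = 0) :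
    Ends parseTransactions s ((w.length + 1) * (10 + (w.length + 1) * 51 + 11)) fun s' =>
      Reads w s' rest ∧ OpTable s' h.allOps := by
  refine Ends.count (N := n) (L := w.length) (c := 10 + (w.length + 1) * 51) (fun i s' =>
    Reads w s' ((((List.finRange n).drop i).flatMap fun t => (h.tr t).code) ++ rest) ∧
      OpTable s' (((List.finRange n).take i).flatMap
        fun t => (h.tr t).ops.map fun o => ((t : ℕ), o))) rfl ?_ ?_ ?_ ?_ le_rfl ?_
  · exact fun s' hf => (hf.1 1 rfl).trans h1
  · have h₁ := hr.length_le
    have h₂ := List.length_le_length_flatMap (fun t => (h.tr t).code)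
      (fun t => by simp [Transaction.code]) (List.finRange n)
    rw [List.length_append] at h₁
    rw [List.length_finRange] at h₂
    omega
  · exact ⟨hr, h2, by simp⟩
  · rintro i s' hi hf h6 ⟨hr', hl'⟩
    have hi' : i < (List.finRange n).length := by simpa using hi
    rw [List.drop_eq_getElem_cons hi', List.flatMap_cons, List.append_assoc] at hr'
    refine (ends_parseTransaction hr' h6 hl').mono le_rfl ?_
    rintro s'' - ⟨h₁, h₂⟩
    refine ⟨h₁, ?_⟩
    rw [List.take_succ_eq_append_getElem hi', List.flatMap_append]
    simpa using
      show OpTable ⟨Function.update s''.reg 6 (i + 1), s''.arr⟩ _ from h₂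
  · rintro s' - - ⟨h₁, h₂⟩
    rw [List.drop_of_length_le (by simp)] at h₁
    rw [List.take_of_length_le (by simp)] at h₂
    exact ⟨h₁, h₂⟩

/-- Register `3` holds the number of entries of `S`, and the arrays `7` and `8` hold the
entries. -/
def SoTable {n : ℕ} (s : State) (S : List (Fin n × Fin n)) : Prop :=
  s.reg 3 = S.length ∧ ∀ (j : ℕ) (a b : Fin n), S[j]? = some (a, b) →
    s.arr 7 j = a ∧ s.arr 8 j = b

/-- Loads the pairs of the session order. -/
def parseSo : Prog :=
  (assign 3 (cell 0 (reg 5)) ;; assign 5 (add (reg 5) (const 1))) ;;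
  count 6 (reg 3)
    (store 7 (reg 6) (cell 0 (reg 5)) ;;
    store 8 (reg 6) (cell 0 (add (reg 5) (const 1))) ;;
    assign 5 (add (reg 5) (const 2)))

theorem ends_parseSo {n : ℕ} {w rest : List ℕ} {s : State} {S : List (Fin n × Fin n)}
    (hr : Reads w s (S.length :: S.flatMap (fun p => [(p.1 : ℕ), (p.2 : ℕ)]) ++ rest)) :
    Ends parseSo s (10 + (w.length + 1) * 41) fun s' => Reads w s' rest ∧ SoTable s' S := by
  have c0 : s.arr 0 (s.reg 5) = S.length := hr.cell_zero
  refine Ends.seq (Q₁ := fun s' =>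
    Reads w s' (S.flatMap (fun p => [(p.1 : ℕ), (p.2 : ℕ)]) ++ rest) ∧
      s'.reg 3 = S.length) ?_ ?_
  · refine Ends.of_straight rfl (by decide) ⟨⟨hr.1, ?_⟩, c0⟩
    change w.drop (s.reg 5 + 1) = _
    rw [← List.drop_drop, hr.2]
    rfl
  · rintro s₁ - ⟨hr₁, h3⟩
    refine Ends.count (N := S.length) (L := w.length) (c := 30) (fun i s' =>
      Reads w s' ((S.drop i).flatMap (fun p => [(p.1 : ℕ), (p.2 : ℕ)]) ++ rest) ∧
        ∀ (j : ℕ) (a b : Fin n), j < i → S[j]? = some (a, b) →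
          s'.arr 7 j = a ∧ s'.arr 8 j = b) rfl ?_ ?_ ?_ ?_ le_rfl ?_
    · exact fun s' hf => (hf.1 3 rfl).trans h3
    · have h₁ := hr₁.length_le
      have h₂ := List.length_le_length_flatMap
        (fun p : Fin n × Fin n => [(p.1 : ℕ), (p.2 : ℕ)]) (fun o => by simp) S
      rw [List.length_append] at h₁
      omega
    · exact ⟨hr₁, fun j a b hj => absurd hj (Nat.not_lt_zero j)⟩
    · rintro i s' hi hf h6 ⟨hr', hl'⟩
      rw [List.drop_eq_getElem_cons hi, List.flatMap_cons, List.append_assoc] at hr'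
      have c0 : s'.arr 0 (s'.reg 5) = S[i].1 := hr'.cell_zero
      have c1 : s'.arr 0 (s'.reg 5 + 1) = S[i].2 := hr'.cell 1
      refine Ends.of_straight rfl (by decide) ⟨⟨hr'.1, ?_⟩, ?_⟩
      · change w.drop (s'.reg 5 + 2) = _
        rw [← List.drop_drop, hr'.2]
        rfl
      · intro j a b hj hjab
        change Function.update (s'.arr 7) (s'.reg 6) (s'.arr 0 (s'.reg 5)) j = _ ∧
          Function.update (s'.arr 8) (s'.reg 6) (s'.arr 0 (s'.reg 5 + 1)) j = _
        rw [c0, c1, h6]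
        rcases Nat.lt_succ_iff_lt_or_eq.1 hj with hj | rfl
        · simpa [Function.update_of_ne hj.ne] using hl' j a b hj hjab
        · rw [List.getElem?_eq_getElem hi, Option.some.injEq] at hjab
          simp [hjab]
    · rintro s' hf - ⟨h₁, h₂⟩
      rw [List.drop_length] at h₁
      refine ⟨h₁, (hf.1 3 rfl).trans h3, fun j a b hj => h₂ j a b ?_ hj⟩
      exact (List.getElem?_eq_some_iff.1 hj).1

/-- Array `6` holds the sources of the reads in the table of operations. -/
def SourceTable {n : ℕ} (s : State) (l : List (ℕ × Op)) (wr : Fin n → Op → Prop) : Prop :=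
  ∀ (j : ℕ) (t : ℕ) (o : Op) (t₁ : Fin n), l[j]? = some (t, o) → wr t₁ o → s.arr 6 j = t₁

/-- Records the source of the operation with the index in register `7`, if the pair of the
write-read relation at the current position of the input gives it. -/
def parseSource : Prog :=
  ifZero
    (add (add (ne (cell 2 (reg 7)) (cell 0 (add (reg 5) (const 1))))
        (ne (cell 3 (reg 7)) (cell 0 (add (reg 5) (const 2)))))
      (add (ne (cell 4 (reg 7)) (cell 0 (add (reg 5) (const 3))))
        (ne (cell 5 (reg 7)) (cell 0 (add (reg 5) (const 4))))))
    (store 6 (reg 7) (cell 0 (reg 5)))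

/-- Loads the pairs of the write-read relation. -/
def parseWr : Prog :=
  (assign 4 (cell 0 (reg 5)) ;; assign 5 (add (reg 5) (const 1))) ;;
  count 6 (reg 4) (count 7 (reg 2) parseSource ;; assign 5 (add (reg 5) (const 5)))

theorem final_skip (s : State) : Prog.skip.final s = s := by
  simp [Prog.skip, Prog.final, Expr.val]

theorem final_ifZero (e : Expr) (p : Prog) (s : State) :
    (ifZero e p).final s = if e.val s = 0 then p.final s else s := by
  simp [ifZero, Prog.final, final_skip]

/-- Each pair of the write-read relation is compared with the whole table, because `wr` concerns an
operation and not its occurrence: all entries equal to that operation receive the source. By `hR`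
the source is unique, so overwriting does no harm. -/
theorem ends_parseWr {n : ℕ} {w : List ℕ} {s : State} {l : List (ℕ × Op)}
    {R : List (Fin n × Op)} (hr : Reads w s (R.length :: R.flatMap fun p => (p.1 : ℕ) :: p.2.code))
    (hl : OpTable s l) (hlen : l.length ≤ w.length)
    (hR : ∀ t₁ t₂ p, p ∈ l → (t₁, p.2) ∈ R → (t₂, p.2) ∈ R → t₁ = t₂) :
    Ends parseWr s (10 + (w.length + 1) * ((w.length + 1) * 111 + 5 + 11)) fun s' =>
      SourceTable s' l fun t o => (t, o) ∈ R := by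
  have c0 : s.arr 0 (s.reg 5) = R.length := hr.cell_zero
  refine Ends.seq (Q₁ := fun s' =>
    Reads w s' (R.flatMap fun p => (p.1 : ℕ) :: p.2.code) ∧ s'.reg 4 = R.length ∧
      OpTable s' l) ?_ ?_
  · refine Ends.of_straight rfl (by decide) ⟨⟨hr.1, ?_⟩, c0, hl⟩
    change w.drop (s.reg 5 + 1) = _
    rw [← List.drop_drop, hr.2]
    rfl
  · rintro s₁ - ⟨hr₁, h4, hl₁⟩
    refine Ends.count (N := R.length) (L := w.length) (c := (w.length + 1) * 111 + 5) (fun i s' =>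
      Reads w s' ((R.drop i).flatMap fun p => (p.1 : ℕ) :: p.2.code) ∧
        SourceTable s' l fun t o => (t, o) ∈ R.take i) rfl ?_ ?_ ?_ ?_ le_rfl ?_
    · exact fun s' hf => (hf.1 4 rfl).trans h4
    · have h₁ := hr₁.length_le
      have h₂ := List.length_le_length_flatMap
        (fun p : Fin n × Op => (p.1 : ℕ) :: p.2.code) (fun o => by simp) R
      omega
    · exact ⟨hr₁, fun j t o t₁ _ h => by simp at h⟩
    · rintro i s' hi hf h6 ⟨hr', hs'⟩
      rw [List.drop_eq_getElem_cons hi, List.flatMap_cons] at hr'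
      have hl' : OpTable s' l := by
        unfold OpTable
        rw [hf.1 2 rfl, hf.2 1 rfl, hf.2 2 rfl, hf.2 3 rfl, hf.2 4 rfl, hf.2 5 rfl]
        exact hl₁
      have htake := List.take_succ_eq_append_getElem hi
      generalize R[i] = p at hr' htake
      obtain ⟨t₀, o₀⟩ := p
      have hmem : ∀ q, q ∈ R.take i → q ∈ R := fun q => List.mem_of_mem_take
      have hmem₀ : (t₀, o₀) ∈ R :=
        List.mem_of_mem_take (i := i + 1) (by rw [htake]; simp)
      refine Ends.seq (m₁ := (w.length + 1) * 111) (m₂ := 5) (Q₁ := fun s'' =>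
        SourceTable s'' l fun t o => (t, o) ∈ R.take (i + 1)) ?_ ?_
      -- Invariant of the inner scan: earlier pairs are recorded everywhere, the current pair only
      -- at positions below `j`.
      · refine Ends.count (N := l.length) (L := w.length) (c := 100) (fun j s'' =>
          ∀ (j' : ℕ) (t : ℕ) (o : Op) (t₁ : Fin n), l[j']? = some (t, o) →
            ((t₁, o) ∈ R.take i ∨ j' < j ∧ (t₁, o) = (t₀, o₀)) → s''.arr 6 j' = t₁)
          rfl ?_ hlen ?_ ?_ le_rfl ?_
        · exact fun s'' hf'' => (hf''.1 2 rfl).trans hl'.1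
        · intro j' t o t₁ hj' hor
          rcases hor with hor | hor
          · exact hs' j' t o t₁ hj' hor
          · exact absurd hor.1 (Nat.not_lt_zero _)
        · rintro j s'' hj hf'' h7 hI
          have hr'' : Reads w s'' (((t₀ : ℕ) :: o₀.code) ++
              (R.drop (i + 1)).flatMap fun p => (p.1 : ℕ) :: p.2.code) :=
            ⟨(hf''.2 0 rfl).trans hr'.1, by rw [hf''.1 5 rfl]; exact hr'.2⟩
          have e0 := hr''.cell_zero
          have e1 := hr''.cell 1
          have e2 := hr''.cell 2
          have e3 := hr''.cell 3
          have e4 := hr''.cell 4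
          rw [Op.code_eq] at e0 e1 e2 e3 e4
          simp only [List.cons_append, List.nil_append, List.getD_cons_zero,
            List.getD_cons_succ] at e0 e1 e2 e3 e4
          obtain ⟨⟨tj, oj⟩, hlj⟩ : ∃ p, l[j] = p := ⟨_, rfl⟩
          have hlj' : l[j]? = some (tj, oj) := by rw [List.getElem?_eq_getElem hj, hlj]
          obtain ⟨-, f2, f3, f4, f5⟩ := hl'.2 j tj oj hlj'
          refine Ends.of_straight rfl (by decide) ?_
          have hcond : ∀ a b c d : ℕ, a + b + (c + d) = 0 ↔ (a = 0 ∧ b = 0) ∧ c = 0 ∧ d = 0 := by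
            intros; omega
          simp only [parseSource, final_ifZero]
          have hval : (Expr.val s''
              (add (add (ne (cell 2 (reg 7)) (cell 0 (add (reg 5) (const 1))))
                (ne (cell 3 (reg 7)) (cell 0 (add (reg 5) (const 2)))))
                (add (ne (cell 4 (reg 7)) (cell 0 (add (reg 5) (const 3))))
                (ne (cell 5 (reg 7)) (cell 0 (add (reg 5) (const 4)))))) = 0) ↔ oj = o₀ := by
            rw [Expr.val, Expr.val, Expr.val, hcond]
            simp only [Expr.val_ne_eq_zero]
            simp only [Expr.val]
            rw [e1, e2, e3, e4, h7, hf''.2 2 rfl, hf''.2 3 rfl, hf''.2 4 rfl, hf''.2 5 rfl,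
              f2, f3, f4, f5]
            exact ⟨fun h => Op.eq_of_fields h.1.1 h.1.2 h.2.1 h.2.2, by rintro rfl; simp⟩
          intro j' t o t₁ hj' hor
          by_cases hoj : oj = o₀
          · rw [if_pos (hval.2 hoj)]
            change Function.update (s''.arr 6) (s''.reg 7) (s''.arr 0 (s''.reg 5)) j' = _
            rw [h7, e0]
            by_cases hjj : j' = j
            · subst hjj
              rw [hlj', Option.some.injEq, Prod.mk.injEq] at hj'
              obtain ⟨rfl, rfl⟩ := hj'
              subst hoj
              rw [Function.update_self]
              have : t₀ = t₁ := by
                refine hR t₀ t₁ _ (List.mem_of_getElem? hlj') hmem₀ ?_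
                rcases hor with hor | hor
                · exact hmem _ hor
                · rw [hor.2]; exact hmem₀
              rw [this]
            · rw [Function.update_of_ne hjj]
              exact hI j' t o t₁ hj' (hor.imp_right fun h => ⟨by omega, h.2⟩)
          · rw [if_neg (fun h => hoj (hval.1 h))]
            refine hI j' t o t₁ hj' (hor.imp_right fun h => ⟨?_, h.2⟩)
            rcases Nat.lt_succ_iff_lt_or_eq.1 h.1 with hlt | rfl
            · exact hlt
            · rw [hlj', Option.some.injEq, Prod.mk.injEq] at hj'
              obtain ⟨rfl, rfl⟩ := hj'
              exact absurd (Prod.mk.inj h.2).2 hoj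
        · rintro s'' - - hI j t o t₁ hj hmem'
          refine hI j t o t₁ hj ?_
          rw [htake, List.mem_append, List.mem_singleton] at hmem'
          exact hmem'.imp_right fun h => ⟨(List.getElem?_eq_some_iff.1 hj).1, h⟩
      · rintro s'' hf'' hs''
        refine Ends.of_straight rfl (by decide) ⟨⟨(hf''.2 0 rfl).trans hr'.1, ?_⟩, hs''⟩
        change w.drop (s''.reg 5 + 5) = _
        rw [hf''.1 5 rfl, ← List.drop_drop, hr'.2, Op.code_eq]
        rfl
    · rintro s' hf - ⟨-, h₂⟩
      rw [List.take_length] at h₂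
      exact h₂

end RAM

/-! ### Translating table scans into statements about the history -/

theorem History.mem_allOps {n : ℕ} {h : History (Fin n)} {t : ℕ} {o : Op} :
    (t, o) ∈ h.allOps ↔ ∃ t' : Fin n, (t' : ℕ) = t ∧ o ∈ (h.tr t').ops := by
  simp only [History.allOps, List.mem_flatMap, List.mem_finRange, true_and, List.mem_map,
    Prod.mk.injEq]
  exact ⟨fun ⟨t', o', h₁, h₂, h₃⟩ => ⟨t', h₂, h₃ ▸ h₁⟩, fun ⟨t', h₂, h₁⟩ => ⟨t', o, h₁, h₂, rfl⟩⟩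

namespace RAM

open RAM.Prog RAM.Expr

/-- The history `h`, whose session order is listed by `S`, has been loaded. -/
structure Loaded {n : ℕ} (h : History (Fin n)) (S : List (Fin n × Fin n)) (s : State) : Prop where
  size : s.reg 1 = n
  ops : OpTable s h.allOps
  so : SoTable s S
  source : SourceTable s h.allOps h.wr

theorem Loaded.of_frame {n : ℕ} {h : History (Fin n)} {S : List (Fin n × Fin n)} {p : Prog}
    {s s' : State} (hl : Loaded h S s) (hf : p.Frame s s')
    (hr : (p.writesReg 1 || p.writesReg 2 || p.writesReg 3) = false)
    (ha : (p.writesArr 1 || p.writesArr 2 || p.writesArr 3 || p.writesArr 4 || p.writesArr 5 ||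
      p.writesArr 6 || p.writesArr 7 || p.writesArr 8) = false) : Loaded h S s' := by
  simp only [Bool.or_eq_false_iff] at hr ha
  obtain ⟨⟨r1, r2⟩, r3⟩ := hr
  obtain ⟨⟨⟨⟨⟨⟨⟨a1, a2⟩, a3⟩, a4⟩, a5⟩, a6⟩, a7⟩, a8⟩ := ha
  obtain ⟨h₁, h₂, h₃, h₄⟩ := hl
  refine ⟨(hf.1 1 r1).trans h₁, ?_, ?_, ?_⟩
  · unfold OpTable
    rwa [hf.1 2 r2, hf.2 1 a1, hf.2 2 a2, hf.2 3 a3, hf.2 4 a4, hf.2 5 a5]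
  · unfold SoTable
    rwa [hf.1 3 r3, hf.2 7 a7, hf.2 8 a8]
  · unfold SourceTable
    rwa [hf.2 6 a6]

/-- A scan yields statements of the form "some table index satisfies a condition"; an arbitrary `F`
lets one lemma serve every scan over reads. The source stored in array `6` is the correct one
because each read has exactly one source. -/
theorem Loaded.exists_read_iff {n : ℕ} {h : History (Fin n)} {S : List (Fin n × Fin n)} {s : State}
    (hl : Loaded h S s) (F : ℕ → ℕ → ℕ → Prop) :
    (∃ j < h.allOps.length, s.arr 2 j = 0 ∧ F (s.arr 4 j) (s.arr 6 j) (s.arr 1 j)) ↔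
      ∃ x t₁ t₂, h.WrVar x t₁ t₂ ∧ F x t₁ t₂ := by
  constructor
  · rintro ⟨j, hj, hk, hF⟩
    obtain ⟨⟨t, o⟩, hlj⟩ : ∃ p, h.allOps[j] = p := ⟨_, rfl⟩
    have hlj' : h.allOps[j]? = some (t, o) := by rw [List.getElem?_eq_getElem hj, hlj]
    obtain ⟨f1, f2, -, f4, -⟩ := hl.ops.2 j t o hlj'
    obtain ⟨t₂, rfl, ho⟩ := History.mem_allOps.1 (List.mem_of_getElem? hlj')
    cases o with
    | write i x v => rw [f2] at hk; cases hk
    | read i x v =>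
      obtain ⟨t₁, hwr, -⟩ := h.wr_total t₂ i x v ho
      rw [f4, hl.source j _ _ _ hlj' hwr, f1] at hF
      exact ⟨x, t₁, t₂, ⟨i, v, ho, hwr⟩, hF⟩
  · rintro ⟨x, t₁, t₂, ⟨i, v, ho, hwr⟩, hF⟩
    obtain ⟨j, hlj⟩ := List.mem_iff_getElem?.1 (History.mem_allOps.2 ⟨t₂, rfl, ho⟩)
    obtain ⟨f1, f2, -, f4, -⟩ := hl.ops.2 j _ _ hlj
    refine ⟨j, (List.getElem?_eq_some_iff.1 hlj).1, f2, ?_⟩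
    rw [f4, hl.source j _ _ _ hlj hwr, f1]
    exact hF

theorem Loaded.exists_write_iff {n : ℕ} {h : History (Fin n)} {S : List (Fin n × Fin n)}
    {s : State} (hl : Loaded h S s) (F : ℕ → ℕ → Prop) :
    (∃ j < h.allOps.length, s.arr 2 j ≠ 0 ∧ F (s.arr 4 j) (s.arr 1 j)) ↔
      ∃ x t, (h.tr t).Writes x ∧ F x t := by
  constructor
  · rintro ⟨j, hj, hk, hF⟩
    obtain ⟨⟨t, o⟩, hlj⟩ : ∃ p, h.allOps[j] = p := ⟨_, rfl⟩
    have hlj' : h.allOps[j]? = some (t, o) := by rw [List.getElem?_eq_getElem hj, hlj]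
    obtain ⟨f1, f2, -, f4, -⟩ := hl.ops.2 j t o hlj'
    obtain ⟨t₂, rfl, ho⟩ := History.mem_allOps.1 (List.mem_of_getElem? hlj')
    cases o with
    | read i x v => exact absurd f2 hk
    | write i x v =>
      rw [f4, f1] at hF
      exact ⟨x, t₂, ⟨i, v, ho⟩, hF⟩
  · rintro ⟨x, t, ⟨i, v, ho⟩, hF⟩
    obtain ⟨j, hlj⟩ := List.mem_iff_getElem?.1 (History.mem_allOps.2 ⟨t, rfl, ho⟩)
    obtain ⟨f1, f2, -, f4, -⟩ := hl.ops.2 j _ _ hlj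
    refine ⟨j, (List.getElem?_eq_some_iff.1 hlj).1, by rw [f2]; exact one_ne_zero, ?_⟩
    rw [f4, f1]
    exact hF

theorem Loaded.exists_so_iff {n : ℕ} {h : History (Fin n)} {S : List (Fin n × Fin n)} {s : State}
    (hl : Loaded h S s) (hS : ∀ t₁ t₂, (t₁, t₂) ∈ S ↔ h.so t₁ t₂) (F : ℕ → ℕ → Prop) :
    (∃ j < S.length, F (s.arr 7 j) (s.arr 8 j)) ↔ ∃ t₁ t₂, h.so t₁ t₂ ∧ F t₁ t₂ := by
  constructor
  · rintro ⟨j, hj, hF⟩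
    obtain ⟨⟨a, b⟩, hlj⟩ : ∃ p, S[j] = p := ⟨_, rfl⟩
    have hlj' : S[j]? = some (a, b) := by rw [List.getElem?_eq_getElem hj, hlj]
    obtain ⟨f1, f2⟩ := hl.so.2 j a b hlj'
    rw [f1, f2] at hF
    exact ⟨a, b, (hS a b).1 (List.mem_of_getElem? hlj'), hF⟩
  · rintro ⟨a, b, hab, hF⟩
    obtain ⟨j, hlj⟩ := List.mem_iff_getElem?.1 ((hS a b).2 hab)
    obtain ⟨f1, f2⟩ := hl.so.2 j a b hlj
    refine ⟨j, (List.getElem?_eq_some_iff.1 hlj).1, ?_⟩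
    rw [f1, f2]
    exact hF

/-! ### Deciding which transactions can be committed next -/

/-- Array `9` holds the powers of two up to the exponent `n`. -/
def Powers (n : ℕ) (s : State) : Prop :=
  ∀ i ≤ n, s.arr 9 i = 2 ^ i

/-- Fills the table of powers of two. -/
def fillPowers : Prog :=
  store 9 (const 0) (const 1) ;;
  count 6 (reg 1) (store 9 (add (reg 6) (const 1)) (add (cell 9 (reg 6)) (cell 9 (reg 6))))

theorem ends_fillPowers {n L : ℕ} {s : State} (h1 : s.reg 1 = n) (hL : n ≤ L) :
    Ends fillPowers s (3 + (L + 1) * 31) (Powers n) := by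
  refine Ends.seq (Q₁ := fun s' => s'.arr 9 0 = 1 ∧ s'.reg 1 = n)
    (Ends.of_straight rfl le_rfl ⟨rfl, h1⟩) ?_
  rintro s₁ - ⟨h9, h1⟩
  refine Ends.count (N := n) (L := L) (c := 20) Powers rfl
    (fun s' hf => (hf.1 1 rfl).trans h1) hL ?_ ?_ le_rfl (fun s' _ _ h => h)
  · intro i hi
    obtain rfl : i = 0 := by omega
    exact h9
  · rintro i s' - - h6 hI
    refine Ends.of_straight rfl (by decide) ?_
    intro j hj
    change Function.update (s'.arr 9) (s'.reg 6 + 1) (s'.arr 9 (s'.reg 6) + s'.arr 9 (s'.reg 6)) j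
      = _
    rw [h6, hI i le_rfl]
    by_cases hji : j = i + 1
    · subst hji
      rw [Function.update_self, pow_succ]
      omega
    · rw [Function.update_of_ne hji]
      exact hI j (by omega)

/-- Writes the binary digits of register `12` to array `12`, and clears the arrays `13` and
`14`. -/
def decode : Prog :=
  assign 13 (reg 12) ;;
  count 6 (reg 1)
    ((assign 8 (sub (sub (reg 1) (const 1)) (reg 6)) ;;
      store 13 (reg 8) (const 0) ;;
      store 14 (reg 8) (const 0)) ;;
    branch (sub (add (reg 13) (const 1)) (cell 9 (reg 8)))
      (store 12 (reg 8) (const 1) ;; assign 13 (sub (reg 13) (cell 9 (reg 8))))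
      (store 12 (reg 8) (const 0)))

/-- Digits are extracted from the top: before round `i`, register `13` holds `m % 2 ^ (n - i)`, and
digit `n - i - 1` is one exactly if this remainder is at least the corresponding power of two. The
flag arrays are reused for every set, so they are cleared in the same pass. -/
theorem ends_decode {n m L : ℕ} {s : State} (h1 : s.reg 1 = n) (hL : n ≤ L) (hp : Powers n s)
    (h12 : s.reg 12 = m) (hm : m < 2 ^ n) :
    Ends decode s (2 + (L + 1) * 61) fun s' => ∀ t < n,
      s'.arr 12 t = (m.testBit t).toNat ∧ s'.arr 13 t = 0 ∧ s'.arr 14 t = 0 := by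
  refine Ends.seq (Q₁ := fun s' => s'.reg 13 = m ∧ s'.reg 1 = n ∧ Powers n s')
    (Ends.of_straight rfl le_rfl ⟨h12, h1, hp⟩) ?_
  rintro s₁ - ⟨h13, h1, hp⟩
  refine Ends.count (N := n) (L := L) (c := 50) (fun i s' => s'.reg 13 = m % 2 ^ (n - i) ∧
    ∀ t < n, n - i ≤ t →
      s'.arr 12 t = (m.testBit t).toNat ∧ s'.arr 13 t = 0 ∧ s'.arr 14 t = 0) rfl
    (fun s' hf => (hf.1 1 rfl).trans h1) hL ?_ ?_ le_rfl ?_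
  · exact ⟨h13.trans (Nat.mod_eq_of_lt hm).symm, fun t ht ht' => absurd ht (by omega)⟩
  · rintro i s' hi hf h6 ⟨hI, hI'⟩
    obtain ⟨d, hd⟩ : ∃ d, n = i + d + 1 := ⟨n - i - 1, by omega⟩
    have h1' : s'.reg 1 = n := (hf.1 1 rfl).trans h1
    have h9 : s'.arr 9 d = 2 ^ d := by
      rw [hf.2 9 rfl]
      exact hp d (by omega)
    have hd' : s'.reg 1 - 1 - s'.reg 6 = d := by omega
    have hni : n - i = d + 1 := by omega
    have hni' : n - (i + 1) = d := by omega
    rw [hni, Nat.mod_two_pow_succ_eq] at hI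
    have hlt : m % 2 ^ d < 2 ^ d := Nat.mod_lt _ (by positivity)
    have key : ∀ b, m.testBit d = b → ∀ t < n, n - (i + 1) ≤ t →
        Function.update (s'.arr 12) d b.toNat t = (m.testBit t).toNat ∧
          Function.update (s'.arr 13) d 0 t = 0 ∧ Function.update (s'.arr 14) d 0 t = 0 := by
      intro b hb t ht ht'
      by_cases htd : t = d
      · subst htd; simp [hb]
      · simpa [Function.update_of_ne htd] using hI' t ht (by omega)
    refine Ends.mono (m := 12 + (6 + 1 + 20)) (Ends.seq (Q₁ := fun s'' => s''.reg 8 = d ∧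
      s''.reg 13 = s'.reg 13 ∧ s''.arr 12 = s'.arr 12 ∧
        s''.arr 13 = Function.update (s'.arr 13) d 0 ∧
          s''.arr 14 = Function.update (s'.arr 14) d 0) ?_ ?_) (by decide) fun _ _ h => h
    · refine Ends.of_straight rfl (by decide) ⟨hd', rfl, rfl, ?_, ?_⟩ <;> rw [← hd'] <;> rfl
    · rintro s'' hf'' ⟨e8, e13, a12, a13, a14⟩
      have h9' : s''.arr 9 (s''.reg 8) = 2 ^ d := by rw [e8, hf''.2 9 rfl, h9]
      rw [hni'] at key
      -- With truncated subtraction, `r + 1 - 2 ^ d` is nonzero exactly if `2 ^ d ≤ r`.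
      refine Ends.branch (fun hc => ?_) (fun hc => ?_)
      · replace hc : s''.reg 13 + 1 - s''.arr 9 (s''.reg 8) ≠ 0 := hc
        rw [h9', e13, hI] at hc
        cases hb : m.testBit d with
        | false => rw [hb, Bool.toNat_false, mul_zero] at hc; omega
        | true =>
          rw [hb, Bool.toNat_true, mul_one] at hI
          refine Ends.of_straight rfl (by decide) ⟨?_, ?_⟩
          · change s''.reg 13 - s''.arr 9 (s''.reg 8) = _
            rw [h9', e13, hI, hni', Nat.add_sub_cancel]
          · change ∀ t < n, n - (i + 1) ≤ t → Function.update (s''.arr 12) (s''.reg 8) 1 t = _ ∧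
              s''.arr 13 t = 0 ∧ s''.arr 14 t = 0
            rw [e8, a12, a13, a14, hni']
            exact key true hb
      · replace hc : s''.reg 13 + 1 - s''.arr 9 (s''.reg 8) = 0 := hc
        rw [h9', e13, hI] at hc
        cases hb : m.testBit d with
        | true => rw [hb, Bool.toNat_true, mul_one] at hc; omega
        | false =>
          rw [hb, Bool.toNat_false, mul_zero, Nat.add_zero] at hI
          refine Ends.of_straight rfl (by decide) ⟨?_, ?_⟩
          · change s''.reg 13 = _
            rw [e13, hI, hni']
          · change ∀ t < n, n - (i + 1) ≤ t → Function.update (s''.arr 12) (s''.reg 8) 0 t = _ ∧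
              s''.arr 13 t = 0 ∧ s''.arr 14 t = 0
            rw [e8, a12, a13, a14, hni']
            exact key false hb
  · rintro s' - - ⟨-, h⟩ t ht
    exact h t ht (by omega)

/-- A loop that sets flags in the array `A`. -/
def mark (r : ℕ) (b e : Expr) (A : ℕ) (idx : Expr) : Prog :=
  count r b (ifZero e (store A idx (const 1)))

/-- Flags are only ever set, so the flagged set becomes its old value together with the image under
`f` of the indices satisfying `C`. The counter must differ from register `0` because `skip` is an
assignment to that register. -/
theorem ends_mark {r A N L m : ℕ} {b e idx : Expr} {s : State} {Q : State → Prop}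
    (C : ℕ → Prop) (f : ℕ → ℕ) (hr : r ≠ 0) (hN : ∀ s', (mark r b e A idx).Frame s s' → b.val s' = N) (hL : N ≤ L)
    (hC : ∀ i s', i < N → (mark r b e A idx).Frame s s' → s'.reg r = i → (e.val s' = 0 ↔ C i))
    (hf : ∀ i s', i < N → (mark r b e A idx).Frame s s' → s'.reg r = i → idx.val s' = f i)
    (hm : (L + 1) * (e.cost + idx.cost + 5 + b.cost + 10) ≤ m)
    (hQ : ∀ s', (∀ t, s'.arr A t ≠ 0 ↔ s.arr A t ≠ 0 ∨ ∃ i < N, C i ∧ f i = t) → Q s') :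
    Ends (mark r b e A idx) s m Q := by
  refine Ends.count (fun i s' => ∀ t, s'.arr A t ≠ 0 ↔ s.arr A t ≠ 0 ∨ ∃ j < i, C j ∧ f j = t)
    (by simpa [ifZero, skip, Prog.writesReg] using hr.symm) hN hL (by simp) ?_ hm
    (fun s' _ _ h => hQ s' h)
  intro i s' hi hfr hri hI
  refine Ends.of_straight rfl (by simp only [ifZero, skip, Prog.steps, Expr.cost]; omega) ?_
  intro t
  have hstep : (∃ j < i + 1, C j ∧ f j = t) ↔ (∃ j < i, C j ∧ f j = t) ∨ C i ∧ f i = t := by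
    constructor
    · rintro ⟨j, hj, h⟩
      rcases Nat.lt_succ_iff_lt_or_eq.1 hj with hj | rfl
      · exact .inl ⟨j, hj, h⟩
      · exact .inr h
    · rintro (⟨j, hj, h⟩ | h)
      · exact ⟨j, by omega, h⟩
      · exact ⟨i, by omega, h⟩
  rw [hstep, ← or_assoc, ← hI t, final_ifZero]
  by_cases hc : e.val s' = 0
  · rw [if_pos hc]
    simp only [Prog.final, Function.update_self, hf i s' hi hfr hri, Expr.val]
    by_cases ht : f i = t
    · subst ht; simp [(hC i s' hi hfr hri).1 hc]
    · simp [ht, Function.update_of_ne (Ne.symm ht)]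
  · rw [if_neg hc]
    have : ¬ C i := fun h => hc ((hC i s' hi hfr hri).2 h)
    simp [this]

end RAM

namespace RAM

open RAM.Prog RAM.Expr

/-! ### Flagging the transactions that cannot be committed -/

/-- Flags in array `13` the transactions with an uncommitted predecessor in the session order. -/
def markSo : Prog :=
  mark 6 (reg 3) (cell 12 (cell 7 (reg 6))) 13 (cell 8 (reg 6))

/-- Flags in array `13` the transactions that read from an uncommitted transaction. -/
def markWr : Prog :=
  mark 6 (reg 2) (add (cell 2 (reg 6)) (cell 12 (cell 6 (reg 6)))) 13 (cell 1 (reg 6))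

/-- Flags in array `14` the transactions that write a variable which a transaction flagged in
array `13` reads from a committed transaction. -/
def markBlocked : Prog :=
  count 6 (reg 2)
    (mark 7 (reg 2)
      (add (add (cell 2 (reg 6)) (sub (const 1) (cell 12 (cell 6 (reg 6)))))
        (add (add (sub (const 1) (cell 13 (cell 1 (reg 6)))) (sub (const 1) (cell 2 (reg 7))))
          (ne (cell 4 (reg 6)) (cell 4 (reg 7)))))
      14 (cell 1 (reg 7)))

/-- Sets flags in the arrays `12`, `13` and `14` for the transactions that cannot be committed right
after the set of transactions given by register `12`. -/
def check : Prog :=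
  decode ;; markSo ;; markWr ;; markBlocked

theorem ends_markSo {n m L : ℕ} {h : History (Fin n)} {S : List (Fin n × Fin n)} {s : State}
    (hl : Loaded h S s) (hS : ∀ t₁ t₂, (t₁, t₂) ∈ S ↔ h.so t₁ t₂) (hL : S.length ≤ L)
    (h12 : ∀ t : Fin n, s.arr 12 t = 0 ↔ t ∉ (History.ofMask m : Set (Fin n)))
    (h13 : ∀ t : Fin n, s.arr 13 t = 0) :
    Ends markSo s ((L + 1) * 30) fun s' => ∀ t : Fin n,
      s'.arr 13 t ≠ 0 ↔ ∃ a, h.so a t ∧ a ∉ (History.ofMask m : Set (Fin n)) := by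
  refine ends_mark (N := S.length) (L := L) (m := (L + 1) * 30)
    (fun j => s.arr 12 (s.arr 7 j) = 0) (fun j => s.arr 8 j)
    (by decide) (fun s' hf => (hf.1 3 rfl).trans hl.so.1) hL ?_ ?_
    (Nat.mul_le_mul_left _ (by decide)) ?_
  · rintro i s' - hf hi
    change s'.arr 12 (s'.arr 7 (s'.reg 6)) = 0 ↔ _
    rw [hi, hf.2 12 rfl, hf.2 7 rfl]
  · rintro i s' - hf hi
    change s'.arr 8 (s'.reg 6) = _
    rw [hi, hf.2 8 rfl]
  · intro s' hQ t
    rw [hQ t, hl.exists_so_iff hS (fun a b => s.arr 12 a = 0 ∧ b = t)]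
    simp only [h13, ne_eq, not_true_eq_false, false_or, Fin.val_inj, h12]
    exact ⟨fun ⟨a, b, hab, h₁, h₂⟩ => ⟨a, h₂ ▸ hab, h₁⟩, fun ⟨a, hab, h₁⟩ => ⟨a, t, hab, h₁, rfl⟩⟩

theorem ends_markWr {n m L : ℕ} {h : History (Fin n)} {S : List (Fin n × Fin n)} {s : State}
    (hl : Loaded h S s) (hL : h.allOps.length ≤ L)
    (h12 : ∀ t : Fin n, s.arr 12 t = 0 ↔ t ∉ (History.ofMask m : Set (Fin n)))
    (h13 : ∀ t : Fin n,
      s.arr 13 t ≠ 0 ↔ ∃ a, h.so a t ∧ a ∉ (History.ofMask m : Set (Fin n))) :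
    Ends markWr s ((L + 1) * 30) fun s' => ∀ t : Fin n,
      s'.arr 13 t ≠ 0 ↔ ∃ a, h.Dep a t ∧ a ∉ (History.ofMask m : Set (Fin n)) := by
  refine ends_mark (N := h.allOps.length) (L := L) (m := (L + 1) * 30)
    (fun j => s.arr 2 j = 0 ∧ s.arr 12 (s.arr 6 j) = 0) (fun j => s.arr 1 j)
    (by decide) (fun s' hf => (hf.1 2 rfl).trans hl.ops.1) hL ?_ ?_
    (Nat.mul_le_mul_left _ (by decide)) ?_
  · rintro i s' - hf hi
    change s'.arr 2 (s'.reg 6) + s'.arr 12 (s'.arr 6 (s'.reg 6)) = 0 ↔ _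
    rw [hi, hf.2 12 rfl, hf.2 2 rfl, hf.2 6 rfl, Nat.add_eq_zero_iff]
  · rintro i s' - hf hi
    change s'.arr 1 (s'.reg 6) = _
    rw [hi, hf.2 1 rfl]
  · intro s' hQ t
    simp only [and_assoc] at hQ
    rw [hQ t, h13, hl.exists_read_iff (fun _ a b => s.arr 12 a = 0 ∧ b = t)]
    simp only [Fin.val_inj, h12]
    constructor
    · rintro (⟨a, hab, ha⟩ | ⟨x, a, b, hab, ha, rfl⟩)
      · exact ⟨a, .inr hab, ha⟩
      · exact ⟨a, .inl ⟨x, hab⟩, ha⟩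
    · rintro ⟨a, ⟨x, hab⟩ | hab, ha⟩
      · exact .inr ⟨x, a, t, hab, ha, rfl⟩
      · exact .inl ⟨a, hab, ha⟩

/-- This is the negated last clause of `CanCommit`. The flags in array `13`, which already say that
a transaction has an uncommitted dependency, are used a second time here, for the reader `t₃`. -/
theorem ends_markBlocked {n m L : ℕ} {h : History (Fin n)} {S : List (Fin n × Fin n)} {s : State}
    (hl : Loaded h S s) (hL : h.allOps.length ≤ L)
    (h12 : ∀ t : Fin n, s.arr 12 t = 0 ↔ t ∉ (History.ofMask m : Set (Fin n)))
    (h13 : ∀ t : Fin n,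
      s.arr 13 t ≠ 0 ↔ ∃ a, h.Dep a t ∧ a ∉ (History.ofMask m : Set (Fin n)))
    (h14 : ∀ t : Fin n, s.arr 14 t = 0) :
    Ends markBlocked s ((L + 1) * ((L + 1) * 60 + 11)) fun s' => ∀ t : Fin n,
      s'.arr 14 t ≠ 0 ↔ ∃ x t₁ t₃ t₄, (h.tr t).Writes x ∧
        t₁ ∈ (History.ofMask m : Set (Fin n)) ∧ h.WrVar x t₁ t₃ ∧ h.Dep t₄ t₃ ∧
          t₄ ∉ (History.ofMask m : Set (Fin n)) := by
  set N := h.allOps.length with hN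
  refine Ends.count (N := N) (L := L) (c := (L + 1) * 60) (fun i s' => ∀ t,
    s'.arr 14 t ≠ 0 ↔ s.arr 14 t ≠ 0 ∨ ∃ i' < i, ∃ j < N, (s.arr 2 i' = 0 ∧
      s.arr 12 (s.arr 6 i') ≠ 0 ∧ s.arr 13 (s.arr 1 i') ≠ 0 ∧ s.arr 2 j ≠ 0 ∧
        s.arr 4 i' = s.arr 4 j) ∧ s.arr 1 j = t) rfl
    (fun s' hf => (hf.1 2 rfl).trans hl.ops.1) hL (by simp) ?_ le_rfl ?_
  · rintro i s' hi hf h6 hI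
    refine ends_mark (N := N) (L := L) (m := (L + 1) * 60)
      (fun j => s.arr 2 i = 0 ∧ s.arr 12 (s.arr 6 i) ≠ 0 ∧ s.arr 13 (s.arr 1 i) ≠ 0 ∧
        s.arr 2 j ≠ 0 ∧ s.arr 4 i = s.arr 4 j) (fun j => s.arr 1 j)
      (by decide) (fun s'' hf' => (hf'.1 2 rfl).trans ((hf.1 2 rfl).trans hl.ops.1)) hL ?_ ?_
      (Nat.mul_le_mul_left _ (by decide)) ?_
    · rintro j s'' - hf' hj
      have e6 : s''.reg 6 = i := (hf'.1 6 rfl).trans h6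
      -- A conjunction is tested as a sum of naturals, which vanishes only if every summand does; `1
      -- - b` vanishes exactly if `b ≠ 0`.
      have g : ∀ a b c d e : ℕ, a + (1 - b) + (1 - c + (1 - d) + e) = 0 ↔
          a = 0 ∧ b ≠ 0 ∧ c ≠ 0 ∧ d ≠ 0 ∧ e = 0 := by intros; omega
      change s''.arr 2 (s''.reg 6) + (1 - s''.arr 12 (s''.arr 6 (s''.reg 6))) +
        (1 - s''.arr 13 (s''.arr 1 (s''.reg 6)) + (1 - s''.arr 2 (s''.reg 7)) +
          (ne (cell 4 (reg 6)) (cell 4 (reg 7))).val s'') = 0 ↔ _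
      rw [g, Expr.val_ne_eq_zero]
      change _ ∧ _ ∧ _ ∧ _ ∧ s''.arr 4 (s''.reg 6) = s''.arr 4 (s''.reg 7) ↔ _
      rw [e6, hj, hf'.2 2 rfl, hf'.2 12 rfl, hf'.2 6 rfl, hf'.2 13 rfl, hf'.2 1 rfl, hf'.2 4 rfl,
        hf.2 2 rfl, hf.2 12 rfl, hf.2 6 rfl, hf.2 13 rfl, hf.2 1 rfl, hf.2 4 rfl]
    · rintro j s'' - hf' hj
      change s''.arr 1 (s''.reg 7) = _
      rw [hj, hf'.2 1 rfl, hf.2 1 rfl]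
    · intro s'' hQ t
      change s''.arr 14 t ≠ 0 ↔ _
      rw [hQ t, hI t, or_assoc]
      refine or_congr_right ?_
      constructor
      · rintro (⟨i', hi', hx⟩ | hx)
        · exact ⟨i', by omega, hx⟩
        · exact ⟨i, by omega, hx⟩
      · rintro ⟨i', hi', hx⟩
        rcases Nat.lt_succ_iff_lt_or_eq.1 hi' with hi' | rfl
        · exact .inl ⟨i', hi', hx⟩
        · exact .inr hx
  · intro s' _ _ hI t
    have hw := fun x => hl.exists_write_iff fun y b => x = y ∧ b = t
    rw [hI t]
    simp only [h14, ne_eq, not_true_eq_false, false_or]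
    constructor
    · rintro ⟨i, hi, j, hj, ⟨h₁, h₂, h₃, h₄, h₅⟩, h₆⟩
      have hex := (hl.exists_read_iff fun x a b => s.arr 12 a ≠ 0 ∧ s.arr 13 b ≠ 0 ∧
        ∃ j < h.allOps.length, s.arr 2 j ≠ 0 ∧ x = s.arr 4 j ∧ s.arr 1 j = t).1
          ⟨i, hi, h₁, h₂, h₃, j, hj, h₄, h₅, h₆⟩
      simp only [hw, h12, h13, Fin.val_inj, ne_eq, not_not] at hex
      obtain ⟨x, t₁, t₃, hwr, hm, ⟨t₄, hd, hm'⟩, _, _, hwx, rfl, rfl⟩ := hex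
      exact ⟨x, t₁, t₃, t₄, hwx, hm, hwr, hd, hm'⟩
    · rintro ⟨x, t₁, t₃, t₄, hwx, hm, hwr, hd, hm'⟩
      obtain ⟨i, hi, h₁, h₂, h₃, j, hj, h₄, h₅, h₆⟩ :=
        (hl.exists_read_iff fun x a b => s.arr 12 a ≠ 0 ∧ s.arr 13 b ≠ 0 ∧
          ∃ j < h.allOps.length, s.arr 2 j ≠ 0 ∧ x = s.arr 4 j ∧ s.arr 1 j = t).2
          ⟨x, t₁, t₃, hwr, fun h0 => (h12 t₁).1 h0 hm, (h13 t₃).2 ⟨t₄, hd, hm'⟩,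
            (hw x).2 ⟨x, t, hwx, rfl, rfl⟩⟩
      exact ⟨i, hi, j, hj, ⟨h₁, h₂, h₃, h₄, h₅⟩, h₆⟩

/-- The three flags negate the three clauses of `CanCommit`, so their sum is zero exactly for the
transactions that can be committed. -/
theorem ends_check {n m L : ℕ} {h : History (Fin n)} {S : List (Fin n × Fin n)} {s : State}
    (hl : Loaded h S s) (hS : ∀ t₁ t₂, (t₁, t₂) ∈ S ↔ h.so t₁ t₂) (hnL : n ≤ L)
    (hSL : S.length ≤ L) (hL : h.allOps.length ≤ L) (hp : Powers n s) (h12 : s.reg 12 = m)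
    (hm : m < 2 ^ n) :
    Ends check s (2 + (L + 1) * 61 + ((L + 1) * 30 + ((L + 1) * 30 +
      (L + 1) * ((L + 1) * 60 + 11)))) fun s' => ∀ t : Fin n,
        s'.arr 12 t + (s'.arr 13 t + s'.arr 14 t) = 0 ↔ h.CanCommit (History.ofMask m) t := by
  refine Ends.seq (ends_decode hl.size hnL hp h12 hm) fun s₁ hf₁ h₁ => ?_
  have hl₁ : Loaded h S s₁ := hl.of_frame hf₁ rfl rfl
  have z₁ : ∀ t : Fin n, s₁.arr 12 t = 0 ↔ t ∉ (History.ofMask m : Set (Fin n)) := by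
    intro t
    rw [(h₁ t t.isLt).1, History.mem_ofMask]
    cases m.testBit t <;> simp
  refine Ends.seq (ends_markSo hl₁ hS hSL z₁ fun t => (h₁ t t.isLt).2.1) fun s₂ hf₂ h₂ => ?_
  have hl₂ : Loaded h S s₂ := hl₁.of_frame hf₂ rfl rfl
  have z₂ : ∀ t : Fin n, s₂.arr 12 t = 0 ↔ t ∉ (History.ofMask m : Set (Fin n)) := by
    rw [hf₂.2 12 rfl]; exact z₁
  refine Ends.seq (ends_markWr hl₂ hL z₂ h₂) fun s₃ hf₃ h₃ => ?_
  have hl₃ : Loaded h S s₃ := hl₂.of_frame hf₃ rfl rfl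
  have z₃ : ∀ t : Fin n, s₃.arr 12 t = 0 ↔ t ∉ (History.ofMask m : Set (Fin n)) := by
    rw [hf₃.2 12 rfl]; exact z₂
  refine (ends_markBlocked hl₃ hL z₃ h₃ ?_).mono le_rfl fun s₄ hf₄ h₄ t => ?_
  · intro t
    rw [hf₃.2 14 rfl, hf₂.2 14 rfl]
    exact (h₁ t t.isLt).2.2
  · have i₁ : s₄.arr 12 t = 0 ↔ t ∉ (History.ofMask m : Set (Fin n)) := by
      rw [hf₄.2 12 rfl]; exact z₃ t
    have i₂ := h₃ t
    rw [← hf₄.2 13 rfl] at i₂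
    rw [Nat.add_eq_zero_iff, Nat.add_eq_zero_iff, i₁, ← not_not (a := s₄.arr 13 t = 0),
      ← not_not (a := s₄.arr 14 t = 0), ← ne_eq, i₂, ← ne_eq (s₄.arr 14 t), h₄ t]
    unfold History.CanCommit
    push Not
    exact Iff.rfl

/-! ### Searching the sets that can be committed -/

/-- The arrays `10` and `11` and register `11` hold the queue `q` of sets found so far. -/
structure Queue {n : ℕ} (h : History (Fin n)) (q : List ℕ) (s : State) : Prop where
  length : s.reg 11 = q.length
  entry : ∀ (j m : ℕ), q[j]? = some m → s.arr 10 j = m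
  mem : ∀ m ∈ q, s.arr 11 m = 1
  notMem : ∀ m, m ∉ q → s.arr 11 m = 0
  nodup : q.Nodup
  reach : ∀ m ∈ q, h.MaskReach m

theorem Queue.congr {n : ℕ} {h : History (Fin n)} {q : List ℕ} {s s' : State} (hq : Queue h q s)
    (h₁ : s'.reg 11 = s.reg 11) (h₂ : s'.arr 10 = s.arr 10) (h₃ : s'.arr 11 = s.arr 11) :
    Queue h q s' := by
  obtain ⟨a, b, c, d, e, f⟩ := hq
  exact ⟨h₁.trans a, by rwa [h₂], by rwa [h₃], by rwa [h₃], e, f⟩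

/-- Appends the set given by register `13` to the queue, unless it has been found before. -/
def enqueue : Prog :=
  ifZero (cell 11 (reg 13))
    (store 11 (reg 13) (const 1) ;;
    store 10 (reg 11) (reg 13) ;;
    assign 11 (add (reg 11) (const 1)))

/-- The new queue is only required to extend the old one: entries keep their positions, so what is
known about processed entries survives. -/
theorem ends_enqueue {n m : ℕ} {h : History (Fin n)} {q : List ℕ} {s : State} (hq : Queue h q s)
    (h13 : s.reg 13 = m) (hm : h.MaskReach m) :
    Ends enqueue s 30 fun s' => ∃ q', q <+: q' ∧ m ∈ q' ∧ Queue h q' s' := by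
  refine Ends.of_straight rfl (by decide) ?_
  rw [enqueue, final_ifZero]
  change ∃ q', q <+: q' ∧ m ∈ q' ∧ Queue h q' (if s.arr 11 (s.reg 13) = 0 then _ else s)
  rw [h13]
  by_cases hmq : m ∈ q
  · rw [if_neg (by rw [hq.mem m hmq]; exact one_ne_zero)]
    exact ⟨q, List.prefix_rfl, hmq, hq⟩
  · rw [if_pos (hq.notMem m hmq)]
    refine ⟨q ++ [m], List.prefix_append _ _, by simp, ?_, ?_, ?_, ?_, ?_, ?_⟩
    · change s.reg 11 + 1 = _
      simp [hq.length]
    · intro j m' hj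
      change Function.update (s.arr 10) (s.reg 11) (s.reg 13) j = m'
      rw [h13, hq.length]
      rcases lt_trichotomy j q.length with hlt | rfl | hlt
      · rw [List.getElem?_append_left hlt] at hj
        rw [Function.update_of_ne hlt.ne]
        exact hq.entry j m' hj
      · rw [List.getElem?_concat_length, Option.some.injEq] at hj
        simp [hj]
      · rw [List.getElem?_eq_none (by simp; omega)] at hj
        cases hj
    · intro m' hm'
      change Function.update (s.arr 11) (s.reg 13) 1 m' = 1
      rw [h13]
      by_cases he : m' = m
      · simp [he]
      · rw [Function.update_of_ne he]
        exact hq.mem m' (by simpa [he] using hm')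
    · intro m' hm'
      change Function.update (s.arr 11) (s.reg 13) 1 m' = 0
      rw [List.mem_append, List.mem_singleton, not_or] at hm'
      rw [h13, Function.update_of_ne hm'.2]
      exact hq.notMem m' hm'.1
    · rw [List.nodup_append]
      exact ⟨hq.nodup, by simp, by rintro a ha b hb rfl; exact hmq (by simp_all)⟩
    · intro m' hm'
      rw [List.mem_append, List.mem_singleton] at hm'
      rcases hm' with hm' | rfl
      · exact hq.reach m' hm'
      · exact hm

/-- Appends to the queue the sets that are obtained from the set given by register `12` when an
unflagged transaction is committed. -/
def expand : Prog :=
  count 6 (reg 1)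
    (ifZero (add (cell 12 (reg 6)) (add (cell 13 (reg 6)) (cell 14 (reg 6))))
      (assign 13 (add (reg 12) (cell 9 (reg 6))) ;; enqueue))

theorem ends_expand {n m L : ℕ} {h : History (Fin n)} {q : List ℕ} {s : State} (hq : Queue h q s)
    (h1 : s.reg 1 = n) (hnL : n ≤ L) (hp : Powers n s) (h12 : s.reg 12 = m) (hm : h.MaskReach m)
    (hc : ∀ t : Fin n, s.arr 12 t + (s.arr 13 t + s.arr 14 t) = 0 ↔
      h.CanCommit (History.ofMask m) t) :
    Ends expand s ((L + 1) * 61) fun s' =>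
      ∃ q', q <+: q' ∧ (∀ m', h.MaskStep m m' → m' ∈ q') ∧ Queue h q' s' := by
  refine Ends.count (N := n) (L := L) (c := 50) (fun i s' => ∃ q', q <+: q' ∧
    (∀ t : Fin n, (t : ℕ) < i → h.CanCommit (History.ofMask m) t → m + 2 ^ (t : ℕ) ∈ q') ∧
      Queue h q' s') rfl (fun s' hf => (hf.1 1 rfl).trans h1) hnL ?_ ?_ le_rfl ?_
  · exact ⟨q, List.prefix_rfl, fun t ht => absurd ht (Nat.not_lt_zero _),
      hq.congr rfl rfl rfl⟩
  · rintro i s' hi hf h6 ⟨q', hqq', hI, hq'⟩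
    have hcost : Expr.cost (add (cell 12 (reg 6)) (add (cell 13 (reg 6)) (cell 14 (reg 6)))) + 1
      + (5 + 30) ≤ 50 := by decide
    have hval : (add (cell 12 (reg 6)) (add (cell 13 (reg 6)) (cell 14 (reg 6)))).val s' = 0 ↔
        h.CanCommit (History.ofMask m) ⟨i, hi⟩ := by
      rw [← hc ⟨i, hi⟩]
      change s'.arr 12 (s'.reg 6) + (s'.arr 13 (s'.reg 6) + s'.arr 14 (s'.reg 6)) = 0 ↔ _
      rw [h6, hf.2 12 rfl, hf.2 13 rfl, hf.2 14 rfl]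
    refine Ends.mono (Ends.branch (m := 5 + 30) (fun hne => ?_) (fun hz => ?_)) hcost
      fun _ _ hQ => hQ
    · refine Ends.of_straight rfl (by decide) ⟨q', hqq', ?_, hq'.congr ?_ ?_ ?_⟩
      · intro t ht hct
        rcases Nat.lt_succ_iff_lt_or_eq.1 ht with ht | rfl
        · exact hI t ht hct
        · exact absurd (hval.2 hct) hne
      · rw [final_skip]; rfl
      · rw [final_skip]
      · rw [final_skip]
    · have hct := hval.1 hz
      have h12' : s'.reg 12 = m := (hf.1 12 rfl).trans h12
      have h9 : s'.arr 9 i = 2 ^ i := by rw [hf.2 9 rfl]; exact hp i hi.le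
      refine Ends.seq (Q₁ := fun s'' => s''.reg 13 = m + 2 ^ i ∧ Queue h q' s'') ?_ ?_
      · refine Ends.of_straight rfl (by decide) ⟨?_, hq'.congr rfl rfl rfl⟩
        change s'.reg 12 + s'.arr 9 (s'.reg 6) = _
        rw [h12', h6, h9]
      · rintro s'' - ⟨h13, hq''⟩
        refine (ends_enqueue hq'' h13 (hm.tail ⟨⟨i, hi⟩, hct, rfl⟩)).mono le_rfl ?_
        rintro s₃ - ⟨q₃, hpre, hmem, hq₃⟩
        refine ⟨q₃, hqq'.trans hpre, ?_, hq₃.congr rfl rfl rfl⟩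
        intro t ht hct'
        rcases Nat.lt_succ_iff_lt_or_eq.1 ht with ht | rfl
        · exact hpre.subset (hI t ht hct')
        · exact hmem
  · rintro s' - - ⟨q', hqq', hI, hq'⟩
    refine ⟨q', hqq', ?_, hq'⟩
    rintro m' ⟨t, ht, rfl⟩
    exact hI t t.isLt ht

/-- Processes the entries of the queue until none is left. -/
def search : Prog :=
  loop (sub (reg 11) (reg 10))
    (assign 12 (cell 10 (reg 10)) ;; check ;; expand ;; assign 10 (add (reg 10) (const 1)))

/-- A bound for the number of steps that process one entry of the queue. -/
def searchStepBound (L : ℕ) : ℕ :=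
  3 + ((2 + (L + 1) * 61 + ((L + 1) * 30 + ((L + 1) * 30 + (L + 1) * ((L + 1) * 60 + 11)))) +
    ((L + 1) * 61 + 4))

/-- Invariant: all successors of the first `i` queue entries are in the queue. At exit the whole
queue is closed under `MaskStep` and contains `0`, so it contains every reachable mask; conversely
only reachable masks are enqueued. -/
theorem ends_search {n k L : ℕ} {h : History (Fin n)} {S : List (Fin n × Fin n)} {s : State}
    (hk : h.width ≤ k) (hl : Loaded h S s) (hS : ∀ t₁ t₂, (t₁, t₂) ∈ S ↔ h.so t₁ t₂)
    (hnL : n ≤ L) (hSL : S.length ≤ L) (hL : h.allOps.length ≤ L) (hp : Powers n s)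
    (h10 : s.reg 10 = 0) (hq : Queue h [0] s) :
    Ends search s (((n + 1) ^ k + 1) * (searchStepBound L + 3 + 1)) fun s' =>
      ∀ m, (h.MaskReach m → s'.arr 11 m = 1) ∧ (¬ h.MaskReach m → s'.arr 11 m = 0) := by
  refine Ends.loop (fun i s' => s'.reg 10 = i ∧ Loaded h S s' ∧ Powers n s' ∧
    ∃ q, Queue h q s' ∧ i ≤ q.length ∧ 0 ∈ q ∧
      ∀ j < i, ∀ m, q[j]? = some m → ∀ m', h.MaskStep m m' → m' ∈ q) ?_ ?_ ?_
  · exact ⟨h10, hl, hp, [0], hq, by simp, by simp, fun j hj => absurd hj (Nat.not_lt_zero j)⟩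
  · rintro i s₁ ⟨hi, hl₁, hp₁, q, hq₁, hiq, h0, hclosed⟩ he
    replace he : s₁.reg 11 - s₁.reg 10 ≠ 0 := he
    rw [hq₁.length, hi] at he
    have hlt : i < q.length := by omega
    -- The width bound enters here: the queue is a repetition-free list of reachable masks, so its
    -- length is at most `(n + 1) ^ k`.
    refine ⟨lt_of_lt_of_le hlt (h.length_le_of_maskReach hk q hq₁.nodup hq₁.reach), ?_⟩
    obtain ⟨m, hqm⟩ : ∃ m, q[i] = m := ⟨_, rfl⟩
    have hqm' : q[i]? = some m := by rw [List.getElem?_eq_getElem hlt, hqm]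
    have hm : h.MaskReach m := hq₁.reach m (List.mem_of_getElem? hqm')
    refine Ends.seq (m₁ := 3) (Q₁ := fun s₂ => s₂.reg 12 = m) ?_ fun s₂ hf₂ h12 => ?_
    · refine Ends.of_straight rfl (by decide) ?_
      change s₁.arr 10 (s₁.reg 10) = m
      rw [hi]
      exact hq₁.entry i m hqm'
    have hl₂ : Loaded h S s₂ := hl₁.of_frame hf₂ rfl rfl
    have hp₂ : Powers n s₂ := by unfold Powers; rw [hf₂.2 9 rfl]; exact hp₁
    have hq₂ : Queue h q s₂ := hq₁.congr (hf₂.1 11 rfl) (hf₂.2 10 rfl) (hf₂.2 11 rfl)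
    refine Ends.seq (ends_check hl₂ hS hnL hSL hL hp₂ h12 hm.lt_and_committable.1)
      fun s₃ hf₃ h₃ => ?_
    have hl₃ : Loaded h S s₃ := hl₂.of_frame hf₃ rfl rfl
    have hp₃ : Powers n s₃ := by unfold Powers; rw [hf₃.2 9 rfl]; exact hp₂
    have hq₃ : Queue h q s₃ := hq₂.congr (hf₃.1 11 rfl) (hf₃.2 10 rfl) (hf₃.2 11 rfl)
    refine Ends.seq (ends_expand hq₃ hl₃.size hnL hp₃ ((hf₃.1 12 rfl).trans h12) hm h₃) ?_
    rintro s₄ hf₄ ⟨q', hqq', hstep, hq₄⟩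
    have hl₄ : Loaded h S s₄ := hl₃.of_frame hf₄ rfl rfl
    have h10₄ : s₄.reg 10 = i := by rw [hf₄.1 10 rfl, hf₃.1 10 rfl, hf₂.1 10 rfl, hi]
    refine Ends.of_straight rfl (by decide) ⟨?_, ⟨hl₄.1, hl₄.2, hl₄.3, hl₄.4⟩, ?_, q',
      hq₄.congr rfl rfl rfl, lt_of_lt_of_le hlt hqq'.length_le, hqq'.subset h0, ?_⟩
    · change s₄.reg 10 + 1 = _
      rw [h10₄]
    · change ∀ j ≤ n, s₄.arr 9 j = 2 ^ j
      rw [hf₄.2 9 rfl]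
      exact hp₃
    · intro j hj m₁ hm₁ m' hm'
      have hjq : j < q.length := by omega
      rw [List.getElem?_eq_getElem (lt_of_lt_of_le hjq hqq'.length_le), Option.some.injEq,
        ← hqq'.getElem hjq] at hm₁
      rcases Nat.lt_succ_iff_lt_or_eq.1 hj with hj | rfl
      · exact hqq'.subset (hclosed j hj m₁ (by rw [List.getElem?_eq_getElem hjq, hm₁]) m' hm')
      · exact hstep m' (by rwa [← hqm, hm₁])
  · rintro i s₁ ⟨hi, -, -, q, hq₁, hiq, h0, hclosed⟩ he
    replace he : s₁.reg 11 - s₁.reg 10 = 0 := he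
    rw [hq₁.length, hi] at he
    -- Induction along a path from `0`: every queue position has been processed, so each step stays
    -- in the queue.
    have hall : ∀ m, h.MaskReach m → m ∈ q := by
      intro m hm
      induction hm with
      | refl => exact h0
      | tail _ hs ih =>
        obtain ⟨j, hj⟩ := List.mem_iff_getElem?.1 ih
        exact hclosed j (by have := (List.getElem?_eq_some_iff.1 hj).1; omega) _ hj _ hs
    exact fun m => ⟨fun hm => hq₁.mem m (hall m hm), fun hm => hq₁.notMem m (mt (hq₁.reach m) hm)⟩

end RAM

/-! ### The complete decision program and its polynomial bound -/

namespace RAM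

open RAM.Prog RAM.Expr

/-- Decides whether the history presented by the input is prefix consistent. -/
def decidePrefix : Prog :=
  (assign 1 (cell 0 (const 0)) ;; assign 5 (const 1)) ;;
  parseTransactions ;;
  parseSo ;;
  parseWr ;;
  fillPowers ;;
  (store 11 (const 0) (const 1) ;; assign 11 (const 1)) ;;
  search ;;
  assign 0 (cell 11 (sub (cell 9 (reg 1)) (const 1)))

/-- A bound for the number of steps of `decidePrefix` on histories of width at most `k`. -/
def decidePrefixBound (k L : ℕ) : ℕ :=
  5 + ((L + 1) * (10 + (L + 1) * 51 + 11) + (10 + (L + 1) * 41 +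
    (10 + (L + 1) * ((L + 1) * 111 + 5 + 11) + (3 + (L + 1) * 31 + (5 +
      (((L + 1) ^ k + 1) * (searchStepBound L + 3 + 1) + 6))))))

/-- The exponent `k` is fixed, so `(L + 1) ^ k` is a polynomial in `L`. -/
theorem exists_polynomial_decidePrefixBound (k : ℕ) :
    ∃ b : Polynomial ℕ, ∀ L, b.eval L = decidePrefixBound k L := by
  refine ⟨5 + ((.X + 1) * (10 + (.X + 1) * 51 + 11) + (10 + (.X + 1) * 41 +
    (10 + (.X + 1) * ((.X + 1) * 111 + 5 + 11) + (3 + (.X + 1) * 31 + (5 +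
      (((.X + 1) ^ k + 1) * ((3 + ((2 + (.X + 1) * 61 + ((.X + 1) * 30 + ((.X + 1) * 30 +
        (.X + 1) * ((.X + 1) * 60 + 11)))) + ((.X + 1) * 61 + 4))) + 3 + 1) + 6)))))), ?_⟩
  intro L
  simp [decidePrefixBound, searchStepBound]

theorem answers_decidePrefix {n k : ℕ} (h : History (Fin n)) (w : List ℕ) (hk : h.width ≤ k)
    (hw : h.Presents w) :
    Answers decidePrefix w (decidePrefixBound k w.length) h.PrefixConsistent := by
  obtain ⟨S, R, hS, hR, hw⟩ := hw
  have hw' : w = n :: (((List.finRange n).flatMap fun t => (h.tr t).code) ++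
      ((S.length :: S.flatMap fun p => [(p.1 : ℕ), (p.2 : ℕ)]) ++
        (R.length :: R.flatMap fun p => (p.1 : ℕ) :: p.2.code))) := by
    rw [hw]; simp
  have hn : n ≤ w.length := by
    have := List.length_le_length_flatMap (fun t => (h.tr t).code)
      (fun t => by simp [Transaction.code]) (List.finRange n)
    rw [List.length_finRange] at this
    rw [hw', List.length_cons, List.length_append]
    omega
  have hSL : S.length ≤ w.length := by
    have := List.length_le_length_flatMap (fun p : Fin n × Fin n => [(p.1 : ℕ), (p.2 : ℕ)])
      (fun p => by simp) S
    rw [hw', List.length_cons, List.length_append, List.length_append, List.length_cons]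
    omega
  have hL : h.allOps.length ≤ w.length := by
    have : h.allOps.length ≤ ((List.finRange n).flatMap fun t => (h.tr t).code).length := by
      rw [History.allOps, List.length_flatMap, List.length_flatMap]
      refine List.sum_le_sum fun t _ => ?_
      have := List.length_le_length_flatMap Op.code (fun o => by simp [Op.code_eq]) (h.tr t).ops
      simp only [List.length_map, Transaction.code, List.length_cons]
      omega
    rw [hw', List.length_cons, List.length_append]
    omega
  have hmain : Ends decidePrefix (start w) (decidePrefixBound k w.length) fun s =>
      (h.PrefixConsistent ∧ s.reg 0 = 1) ∨ (¬ h.PrefixConsistent ∧ s.reg 0 = 0) := by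
    refine Ends.seq (Q₁ := fun s => Reads w s (w.drop 1) ∧ s.reg 1 = n)
      (Ends.of_straight rfl (by decide) ⟨⟨rfl, rfl⟩, ?_⟩) ?_
    · change w.getD 0 0 = n
      rw [hw']; rfl
    rintro s₁ hf₁ ⟨hr₁, h1⟩
    replace hr₁ : Reads w s₁ (((List.finRange n).flatMap fun t => (h.tr t).code) ++
      ((S.length :: S.flatMap fun p => [(p.1 : ℕ), (p.2 : ℕ)]) ++
        (R.length :: R.flatMap fun p => (p.1 : ℕ) :: p.2.code))) := by
      refine ⟨hr₁.1, hr₁.2.trans ?_⟩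
      conv_lhs => rw [hw']
      rfl
    refine Ends.seq (ends_parseTransactions h hr₁ h1 (hf₁.1 2 rfl)) ?_
    rintro s₂ hf₂ ⟨hr₂, ht₂⟩
    refine Ends.seq (ends_parseSo hr₂) ?_
    rintro s₃ hf₃ ⟨hr₃, hs₃⟩
    have ht₃ : OpTable s₃ h.allOps := by
      unfold OpTable
      rwa [hf₃.1 2 rfl, hf₃.2 1 rfl, hf₃.2 2 rfl, hf₃.2 3 rfl, hf₃.2 4 rfl, hf₃.2 5 rfl]
    refine Ends.seq (ends_parseWr hr₃ ht₃ hL ?_) ?_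
    · rintro t₁ t₂ ⟨t, o⟩ hto h₁ h₂
      rw [hR] at h₁ h₂
      obtain ⟨t', -, ho⟩ := History.mem_allOps.1 hto
      obtain ⟨i, x, v, rfl, -⟩ := h.wr_read t₁ o h₁
      exact (h.wr_total t' i x v ho).unique h₁ h₂
    intro s₄ hf₄ hsrc
    have hl₄ : Loaded h S s₄ := by
      refine ⟨?_, ?_, ?_, ?_⟩
      · rw [hf₄.1 1 rfl, hf₃.1 1 rfl, hf₂.1 1 rfl, h1]
      · unfold OpTable
        rwa [hf₄.1 2 rfl, hf₄.2 1 rfl, hf₄.2 2 rfl, hf₄.2 3 rfl, hf₄.2 4 rfl, hf₄.2 5 rfl]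
      · unfold SoTable
        rwa [hf₄.1 3 rfl, hf₄.2 7 rfl, hf₄.2 8 rfl]
      · exact fun j t o t₁ hj hwr => hsrc j t o t₁ hj ((hR _ _).2 hwr)
    refine Ends.seq (ends_fillPowers hl₄.size hn) fun s₅ hf₅ hp₅ => ?_
    have hl₅ : Loaded h S s₅ := hl₄.of_frame hf₅ rfl rfl
    have z10 : ∀ i, s₅.arr 10 i = 0 := by
      rw [hf₅.2 10 rfl, hf₄.2 10 rfl, hf₃.2 10 rfl, hf₂.2 10 rfl, hf₁.2 10 rfl]
      exact fun _ => rfl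
    have z11 : ∀ i, s₅.arr 11 i = 0 := by
      rw [hf₅.2 11 rfl, hf₄.2 11 rfl, hf₃.2 11 rfl, hf₂.2 11 rfl, hf₁.2 11 rfl]
      exact fun _ => rfl
    have r10 : s₅.reg 10 = 0 := by
      rw [hf₅.1 10 rfl, hf₄.1 10 rfl, hf₃.1 10 rfl, hf₂.1 10 rfl, hf₁.1 10 rfl]
      rfl
    refine Ends.seq (m₁ := 5) (Q₁ := Queue h [0])
      (Ends.of_straight rfl (by decide) ⟨rfl, ?_, ?_, ?_, by simp, ?_⟩) fun s₆ hf₆ hq₆ => ?_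
    -- The first queue cell needs no store: fresh memory already holds `0`, the mask of the empty
    -- set.
    · intro j m hj
      change s₅.arr 10 j = m
      rw [z10]
      have := List.mem_of_getElem? hj
      simp_all
    · intro m hm
      rw [List.mem_singleton] at hm
      subst hm
      rfl
    · intro m hm
      change Function.update (s₅.arr 11) 0 1 m = 0
      rw [Function.update_of_ne (by simpa using hm), z11]
    · intro m hm
      rw [List.mem_singleton] at hm
      subst hm
      exact .refl
    have hl₆ : Loaded h S s₆ := hl₅.of_frame hf₆ rfl rfl
    have hp₆ : Powers n s₆ := by unfold Powers; rw [hf₆.2 9 rfl]; exact hp₅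
    refine Ends.seq (m₁ := ((w.length + 1) ^ k + 1) * (searchStepBound w.length + 3 + 1))
      ((ends_search hk hl₆ hS hn hSL hL hp₆ ((hf₆.1 10 rfl).trans r10) hq₆).mono
        (Nat.mul_le_mul_right _ (Nat.add_le_add_right (Nat.pow_le_pow_left (by omega) k) 1))
        fun _ _ hQ => hQ) fun s₇ hf₇ h₇ => ?_
    refine Ends.of_straight rfl (by decide) ?_
    -- The answer is the visited flag of the mask `2 ^ n - 1` of the full set.
    change (_ ∧ s₇.arr 11 (s₇.arr 9 (s₇.reg 1) - 1) = 1) ∨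
      (_ ∧ s₇.arr 11 (s₇.arr 9 (s₇.reg 1) - 1) = 0)
    rw [hf₇.1 1 rfl, hl₆.size, hf₇.2 9 rfl, hp₆ n le_rfl, h.prefixConsistent_iff_maskReach]
    by_cases hm : h.MaskReach (2 ^ n - 1)
    · exact .inl ⟨hm, (h₇ _).1 hm⟩
    · exact .inr ⟨hm, (h₇ _).2 hm⟩
  obtain ⟨m', s, hm', hrun, hs⟩ := hmain
  exact ⟨m', s, hm', hrun, hs⟩

end RAM

/-- For every fixed `k`, checking prefix consistency of histories of width at most `k` is
polynomial time: one program decides it, in a number of steps that is bounded by a polynomial in the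
length of the input. -/
theorem mainTheorem9 (k : ℕ) :
    ∃ (p : RAM.Prog) (b : Polynomial ℕ),
      ∀ (n : ℕ) (h : History (Fin n)) (w : List ℕ), h.width ≤ k → h.Presents w →
        RAM.Answers p w (b.eval w.length) h.PrefixConsistent := by
  obtain ⟨b, hb⟩ := RAM.exists_polynomial_decidePrefixBound k
  exact ⟨RAM.decidePrefix, b, fun n h w hk hw => hb w.length ▸ RAM.answers_decidePrefix h w hk hw⟩
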